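/- **Setting.** Let $1\le K\le N$, $0<c_{\min}\le 1$ and let $B\ge Kc_{\min}$ be a budget. An environment is a sequence of rewards $r_i(t)\in[0,1]$ and costs $c_i(t)\in[c_{\min},1]$ ($i\in[N]$, $t\ge 1$) that is fixed in advance. In each round $t$ a randomized algorithm $\mathcal A$ draws a set $a_t$ of exactly $K$ distinct arms, depending only on its past observations. If $\sum_{i\in a_t}c_i(t)$ exceeds the remaining budget, the game ends; otherwise this sum is subtracted from the budget, the reward $\sum_{i\in a_t}r_i(t)$ is added to the gain, and $\mathcal A$ observes $r_i(t),c_i(t)$ for $i\in a_t$ (and nothing else). Let $G_{\mathcal A}(B)$ be the total gain, let $G_{\max}(B)$ be the largest gain of an algorithm that plays one fixed set of $K$ arms in every round under the same budget, and let the weak regret be $\mathcal R=G_{\max}(B)-\mathbb E[G_{\mathcal A}(B)]$, where the expectation is over the internal randomness of $\mathcal A$. **Theorem.** Let $\mathcal A$ be any such algorithm, in particular $\texttt{Exp3.M.B}$ with any parameter $\gamma\in(0,1]$ and any rounding procedure that draws sets of $K$ arms with prescribed inclusion probabilities. 1. For every $\varepsilon\in(0,1/4]$ there is an environment in which $$\mathcal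 R\ \ge\ \varepsilon\left(B-\frac{BK}{N}-2Bc_{\min}^{-3/2}\,\varepsilon\sqrt{\frac{BK\log(4/3)}{N}}\right).$$ 2. There is an environment in which $$\mathcal R\ \ge\ \min\left(\frac{c_{\min}^{3/2}(1-K/N)^2}{8\sqrt{\log(4/3)}}\sqrt{\frac{NB}{K}},\ \frac{B(1-K/N)}{8}\right).$$ 3. Suppose moreover that $B$ is a positive integer multiple of $K$ or that $B(1-c_{\min})\ge K(1+c_{\min})$. For a number $\varepsilon\in[0,1/4]$ consider the following random environment: a set of $K$ good arms is drawn uniformly at random; then all rewards and costs are independent, the rewards of a good arm are $1$ with probability $\frac12+\varepsilon$ and $0$ otherwise, its costs are $c_{\min}$ with probability $\frac12+\varepsilon$ and $1$ otherwise, and for each other arm both probabilities are $\frac12$. Then for every $\varepsilon\in(0,1/4]$ the weak regret is integrable and its expectation over the random environment satisfies the inequality in 1; and for $$\varepsilon=\min\left(\frac14,\ \frac{(1-K/N)c_{\min}^{3/2}}{4\sqrt{\log(4/3)}}\sqrt{\frac{N}{BK}}\right)$$ this expectation satisfies the inequality in 2. -/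

import Mathlib

open scoped BigOperators

noncomputable section

namespace BudgetedBandit

/-- The possible actions in a round: sets of exactly `K` distinct arms out of `N`. -/
abbrev Arms (N K : ℕ) : Type := {a : Finset (Fin N) // a.card = K}

/-- A sequence of rewards and costs, fixed in advance (oblivious adversary).
Rounds are numbered `0, 1, 2, …`. -/
structure Environment (N : ℕ) where
  reward : ℕ → Fin N → ℝ
  cost : ℕ → Fin N → ℝ

/-- Rewards lie in `[0, 1]` and costs in `[c, 1]`. -/
structure Environment.IsAdmissible {N : ℕ} (x : Environment N) (c : ℝ) : Prop where
  reward_mem : ∀ t i, x.reward t i ∈ Set.Icc (0 : ℝ) 1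
  cost_mem : ∀ t i, x.cost t i ∈ Set.Icc c 1

/-- What the player sees in one round (semi-bandit feedback): the set that was played, and the
reward and the cost of each arm in that set, and nothing about the other arms. -/
structure Observation (N K : ℕ) where
  arms : Arms N K
  reward : arms.1 → ℝ
  cost : arms.1 → ℝ

/-- A randomized algorithm: for every history of observations (the most recent one first) a
probability distribution on the set of arms to be played next. -/
abbrev Policy (N K : ℕ) : Type := List (Observation N K) → PMF (Arms N K)

/-- The algorithm that plays the set `a` in every round. -/
def fixedPolicy {N K : ℕ} (a : Arms N K) : Policy N K := fun _ => PMF.pure a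

namespace Environment

variable {N K : ℕ}

/-- Total reward of the set `a` in round `t`. -/
def roundReward (x : Environment N) (t : ℕ) (a : Arms N K) : ℝ := ∑ i ∈ a.1, x.reward t i

/-- Total cost of the set `a` in round `t`. -/
def roundCost (x : Environment N) (t : ℕ) (a : Arms N K) : ℝ := ∑ i ∈ a.1, x.cost t i

/-- The observation made when `a` is played in round `t`. -/
def observe (x : Environment N) (t : ℕ) (a : Arms N K) : Observation N K :=
  ⟨a, fun i => x.reward t i, fun i => x.cost t i⟩

end Environment

/-- Expected gain, over the internal randomness of `π`, of the next at most `n` rounds, when the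
history so far is `h` and the remaining budget is `b`. A set is drawn; if its cost exceeds the
remaining budget, the game ends without the reward of that round, otherwise the cost is paid, the
reward is collected and the game goes on. -/
def gainWithin {N K : ℕ} (π : Policy N K) (x : Environment N) :
    ℕ → List (Observation N K) → ℝ → ℝ
  | 0, _, _ => 0
  | n + 1, h, b =>
      ∑ a : Arms N K, (π h a).toReal *
        (if x.roundCost h.length a ≤ b then
          x.roundReward h.length a +
            gainWithin π x n (x.observe h.length a :: h) (b - x.roundCost h.length a)
        else 0)

/-- The largest number of rounds that the budget `B` can pay for, as every round costs at least
`K * c`. -/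
def maxRounds (K : ℕ) (c B : ℝ) : ℕ := ⌊B / (K * c)⌋₊

/-- The expected gain `E[G_π(B)]` of `π` in the environment `x`, with budget `B`, when all costs
are at least `c`. -/
def expectedGain {N K : ℕ} (π : Policy N K) (x : Environment N) (c B : ℝ) : ℝ :=
  gainWithin π x (maxRounds K c B) [] B

theorem gainWithin_succ_eq {N K : ℕ} {c : ℝ} (π : Policy N K)
    {x : Environment N} (hx : x.IsAdmissible c) (n : ℕ) :
    ∀ (h : List (Observation N K)) (b : ℝ), b < ((n : ℝ) + 1) * (K * c) →
      gainWithin π x (n + 1) h b = gainWithin π x n h b := by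
  have hcost : ∀ t (a : Arms N K), (K : ℝ) * c ≤ x.roundCost t a := by
    intro t a
    have h1 := Finset.card_nsmul_le_sum a.1 (fun i => x.cost t i) c
      (fun i _ => (hx.cost_mem t i).1)
    rw [a.2, nsmul_eq_mul] at h1
    exact h1
  induction n with
  | zero =>
    intro h b hb
    simp only [gainWithin]
    refine Finset.sum_eq_zero fun a _ => ?_
    have h1 := hcost h.length a
    rw [if_neg, mul_zero]
    push_cast at hb
    linarith
  | succ n ih =>
    intro h b hb
    rw [gainWithin, gainWithin]
    refine Finset.sum_congr rfl fun a _ => ?_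
    have h1 := hcost h.length a
    rw [ih]
    push_cast at hb
    linarith

/-- Allowing more than `maxRounds` rounds does not change the gain: the game that defines
`expectedGain` is never cut off before the budget is exhausted. -/
theorem gainWithin_eq_expectedGain {N K : ℕ} (hK : 1 ≤ K) {c : ℝ} (hc : 0 < c)
    (π : Policy N K) {x : Environment N} (hx : x.IsAdmissible c) (B : ℝ) (n : ℕ)
    (hn : maxRounds K c B ≤ n) : gainWithin π x n [] B = expectedGain π x c B := by
  induction n, hn using Nat.le_induction with
  | base => rfl
  | succ m hm ih =>
    rw [← ih]
    apply gainWithin_succ_eq π hx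
    have hpos : (0 : ℝ) < K * c := mul_pos (by exact_mod_cast hK) hc
    have h1 : B / (K * c) < (maxRounds K c B : ℝ) + 1 := Nat.lt_floor_add_one _
    have h2 : (maxRounds K c B : ℝ) ≤ m := by exact_mod_cast hm
    rw [← div_lt_iff₀ hpos]
    linarith

/-- Weak regret: the gain of the best fixed set of `K` arms (in hindsight, under the same budget)
minus the expected gain of `π`. -/
def weakRegret {N K : ℕ} (π : Policy N K) (x : Environment N) (c B : ℝ) : ℝ :=
  (⨆ a : Arms N K, expectedGain (fixedPolicy a) x c B) - expectedGain π x c B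

/-! ### The random environment with a planted set of good arms -/

/-- For every round and arm two bits: the reward bit, and the bit that says whether the arm is
cheap. -/
abbrev Bits (N : ℕ) : Type := ℕ × Fin N → Bool × Bool

/-- The environment with rewards in `{0, 1}` and costs in `{c, 1}` that is encoded by `ω`. -/
def bitEnvironment {N : ℕ} (c : ℝ) (ω : Bits N) : Environment N where
  reward t i := if (ω (t, i)).1 then 1 else 0
  cost t i := if (ω (t, i)).2 then c else 1

/-- The probability of reward `1`, and of cost `c`, for arm `i` when the good set is `s`:
`1/2 + ε` for good arms and `1/2` for the others. -/
def bitProb {N : ℕ} (ε : ℝ) (s : Finset (Fin N)) (i : Fin N) : unitInterval :=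
  Set.projIcc (0 : ℝ) 1 zero_le_one (if i ∈ s then 1 / 2 + ε else 1 / 2)

/-- All bits are independent, with the probabilities `bitProb ε s`. -/
def plantedLaw {N : ℕ} (ε : ℝ) (s : Finset (Fin N)) : MeasureTheory.Measure (Bits N) :=
  MeasureTheory.Measure.infinitePi fun j : ℕ × Fin N =>
    (ProbabilityTheory.bernoulliMeasure true false (bitProb ε s j.2)).prod
      (ProbabilityTheory.bernoulliMeasure true false (bitProb ε s j.2))

/-- The expected weak regret of `π` when the good set is drawn uniformly from all sets of `K` arms
and then rewards and costs are drawn from the planted law. -/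
def plantedRegret {N K : ℕ} (π : Policy N K) (ε c B : ℝ) : ℝ :=
  (∑ s : Arms N K, ∫ ω, weakRegret π (bitEnvironment c ω) c B ∂(plantedLaw ε s.1)) /
    (Fintype.card (Arms N K) : ℝ)

/-! ### The algorithm Exp3.M.B -/

/-- A randomized rounding procedure: it turns inclusion probabilities `p` with `∑ i, p i = K` into
a random set of `K` arms that contains each arm `i` with probability `p i`. -/
structure Rounding (N K : ℕ) where
  law : (Fin N → ℝ) → PMF (Arms N K)
  marginal : ∀ p : Fin N → ℝ, (∀ i, p i ∈ Set.Icc (0 : ℝ) 1) → ∑ i, p i = K →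
    ∀ i, ∑ a : Arms N K, (if i ∈ a.1 then (law p a).toReal else 0) = p i

section Exp3MB

variable {N : ℕ} (K : ℕ) (γ : ℝ) (w : Fin N → ℝ)

/-- Some weight is so large that the weights have to be capped. -/
def NeedsCap : Prop :=
  ∃ i, (1 / (K : ℝ) - γ / N) * ∑ j, w j / (1 - γ) ≤ w i

open Classical in
/-- The capping value `v`, a positive solution of
`1/K - γ/N = v (1 - γ) / (∑ v 1(w i ≥ v) + w i 1(w i < v))`. -/
def capValue : ℝ :=
  Classical.epsilon fun v : ℝ => 0 < v ∧
    1 / (K : ℝ) - γ / N = v * (1 - γ) / ∑ i, (if v ≤ w i then v else w i)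

/-- Arm `i` belongs to the set of capped arms. -/
def IsCapped (i : Fin N) : Prop := NeedsCap K γ w ∧ capValue K γ w ≤ w i

open Classical in
def cappedWeight (i : Fin N) : ℝ := if IsCapped K γ w i then capValue K γ w else w i

/-- The probability that arm `i` is included in the set to be played. -/
def playProb (i : Fin N) : ℝ :=
  K * ((1 - γ) * (cappedWeight K γ w i / ∑ j, cappedWeight K γ w j) + γ / N)

end Exp3MB

open Classical in
/-- The weights of Exp3.M.B after a given history. The estimates are `r / p` and `c / p` for the
arms played and `0` for the others; the weights of capped arms are not updated. -/
def exp3Weight {N K : ℕ} (γ : ℝ) : List (Observation N K) → Fin N → ℝ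
  | [] => fun _ => 1
  | o :: h => fun i =>
      exp3Weight γ h i * Real.exp (K * γ / N *
        ((if hi : i ∈ o.arms.1 then o.reward ⟨i, hi⟩ / playProb K γ (exp3Weight γ h) i else 0) -
          (if hi : i ∈ o.arms.1 then o.cost ⟨i, hi⟩ / playProb K γ (exp3Weight γ h) i else 0)) *
        (if IsCapped K γ (exp3Weight γ h) i then 0 else 1))

/-- Exp3.M.B with parameter `γ` and a given rounding procedure. The termination rule is the one
that is built into `gainWithin`. -/
def exp3MB {N K : ℕ} (γ : ℝ) (D : Rounding N K) : Policy N K :=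
  fun h => D.law (playProb K γ (exp3Weight γ h))

end BudgetedBandit

end

open scoped BigOperators

noncomputable section

namespace BudgetedBandit

/-! ### Expectations under finite product laws -/

/-- Expectation of `F` when the coordinates are independent with weights `p i`. -/
def prodExp {ι X : Type*} [Fintype ι] [DecidableEq ι] [Fintype X] (p : ι → X → ℝ)
    (F : (ι → X) → ℝ) : ℝ :=
  ∑ x : ι → X, (∏ i, p i (x i)) * F x

section ProdExp

variable {ι X : Type*} [Fintype ι] [DecidableEq ι] [Fintype X]

theorem prodExp_mono {p : ι → X → ℝ} (hp : ∀ i y, 0 ≤ p i y) {F G : (ι → X) → ℝ}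
    (h : ∀ x, F x ≤ G x) : prodExp p F ≤ prodExp p G :=
  Finset.sum_le_sum fun x _ =>
    mul_le_mul_of_nonneg_left (h x) (Finset.prod_nonneg fun i _ => hp i _)

theorem prodExp_add (p : ι → X → ℝ) (F G : (ι → X) → ℝ) :
    prodExp p (fun x => F x + G x) = prodExp p F + prodExp p G := by
  simp only [prodExp, mul_add, Finset.sum_add_distrib]

theorem prodExp_const_mul (p : ι → X → ℝ) (k : ℝ) (F : (ι → X) → ℝ) :
    prodExp p (fun x => k * F x) = k * prodExp p F := by
  simp only [prodExp, Finset.mul_sum]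
  exact Finset.sum_congr rfl fun x _ => by ring

theorem prodExp_sum {κ : Type*} (p : ι → X → ℝ) (t : Finset κ) (F : κ → (ι → X) → ℝ) :
    prodExp p (fun x => ∑ k ∈ t, F k x) = ∑ k ∈ t, prodExp p (F k) := by
  simp only [prodExp, Finset.mul_sum]
  exact Finset.sum_comm

theorem prodExp_const {p : ι → X → ℝ} (hp : ∀ i, ∑ y, p i y = 1) (k : ℝ) :
    prodExp p (fun _ => k) = k := by
  rw [prodExp, ← Finset.sum_mul]
  have := Finset.prod_univ_sum (fun _ : ι => (Finset.univ : Finset X)) p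
  rw [Fintype.piFinset_univ] at this
  rw [← this]
  simp [hp]

/-- Conditioning on one coordinate, whose law may be changed afterwards. -/
theorem prodExp_update {p p' : ι → X → ℝ} (i : ι) (h : ∀ j, j ≠ i → p' j = p j)
    (hp' : ∑ y, p' i y = 1) (F : (ι → X) → ℝ) :
    prodExp p F = ∑ y, p i y * prodExp p' (fun x => F (Function.update x i y)) := by
  have key : ∀ (q : ι → X → ℝ) (x : ι → X),
      ∏ j, q j (x j) = q i (x i) * ∏ j ∈ Finset.univ.erase i, q j (x j) := fun q x =>
    (Finset.mul_prod_erase _ _ (Finset.mem_univ i)).symm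
  let e : X × (ι → X) → X × (ι → X) := fun z => (z.2 i, Function.update z.2 i z.1)
  have he : Function.Involutive e := by
    rintro ⟨y, x⟩
    simp [e]
  calc prodExp p F
      = ∑ z : X, ∑ x : ι → X, p' i z * ((∏ j, p j (x j)) * F x) := by
        rw [Finset.sum_comm]
        simp only [← Finset.sum_mul, hp', one_mul]
        rfl
    _ = ∑ z : X × (ι → X), p' i z.1 * ((∏ j, p j (z.2 j)) * F z.2) := by
        rw [Fintype.sum_prod_type]
    _ = ∑ z : X × (ι → X), p' i (e z).1 * ((∏ j, p j ((e z).2 j)) * F (e z).2) :=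
        (Equiv.sum_comp he.toPerm
          (fun z : X × (ι → X) => p' i z.1 * ((∏ j, p j (z.2 j)) * F z.2))).symm
    _ = ∑ z : X × (ι → X),
          p i z.1 * ((∏ j, p' j (z.2 j)) * F (Function.update z.2 i z.1)) := by
        refine Finset.sum_congr rfl fun z _ => ?_
        simp only [e]
        rw [key p, key p', Function.update_self]
        have : ∏ j ∈ Finset.univ.erase i, p j (Function.update z.2 i z.1 j)
            = ∏ j ∈ Finset.univ.erase i, p' j (z.2 j) := by
          refine Finset.prod_congr rfl fun j hj => ?_
          have hj := Finset.ne_of_mem_erase hj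
          rw [Function.update_of_ne hj, h j hj]
        rw [this]
        ring
    _ = _ := by
        rw [Fintype.sum_prod_type]
        simp only [prodExp, Finset.mul_sum]

theorem prodExp_update_self {p : ι → X → ℝ} (i : ι) (hp : ∑ y, p i y = 1)
    (F : (ι → X) → ℝ) :
    prodExp p F = ∑ y, p i y * prodExp p (fun x => F (Function.update x i y)) :=
  prodExp_update i (fun _ _ => rfl) hp F

/-- The expectation of a function of the coordinates in `a` only depends on their laws. -/
theorem prodExp_congr_law {p p' : ι → X → ℝ} (hp : ∀ i, ∑ y, p i y = 1)
    (hp' : ∀ i, ∑ y, p' i y = 1) {a : Finset ι} (h : ∀ i ∈ a, p i = p' i)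
    {F : (ι → X) → ℝ} (hF : ∀ i ∉ a, ∀ x y, F (Function.update x i y) = F x) :
    prodExp p F = prodExp p' F := by
  have key : ∀ t : Finset ι, Disjoint t a →
      prodExp (fun i => if i ∈ t then p' i else p i) F = prodExp p F := by
    intro t
    induction t using Finset.induction_on with
    | empty => simp
    | insert i t hi ih =>
      intro hd
      rw [Finset.disjoint_insert_left] at hd
      rw [← ih hd.2, prodExp_update (p' := fun i => if i ∈ t then p' i else p i) i]
      · simp only [hF i hd.1, Finset.mem_insert_self, if_true, ← Finset.sum_mul, hp', one_mul]
      · intro j hj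
        simp [hj]
      · simp only [hi, if_false, hp]
  rw [← key aᶜ disjoint_compl_left]
  congr 1
  funext i
  by_cases hi : i ∈ a
  · simp [hi, h i hi]
  · simp [hi]

end ProdExp

/-! ### Averages over independent costs with two values -/

/-- The average of `φ` after one more cost, which is `lo` with probability `q` and else `hi`. -/
def costAvg (lo hi q : ℝ) (φ : ℝ → ℝ) (z : ℝ) : ℝ := q * φ (z + lo) + (1 - q) * φ (z + hi)

section CostAvg

variable {lo hi q : ℝ}

theorem costAvg_antitone (h0 : 0 ≤ q) (h1 : q ≤ 1) {φ : ℝ → ℝ} (hφ : Antitone φ) :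
    Antitone (costAvg lo hi q φ) := fun z z' hz =>
  add_le_add
    (mul_le_mul_of_nonneg_left (hφ (by linarith)) h0)
    (mul_le_mul_of_nonneg_left (hφ (by linarith)) (by linarith))

theorem costAvg_iterate_antitone (h0 : 0 ≤ q) (h1 : q ≤ 1) {φ : ℝ → ℝ} (hφ : Antitone φ)
    (k : ℕ) : Antitone ((costAvg lo hi q)^[k] φ) := by
  induction k with
  | zero => exact hφ
  | succ k ih =>
    rw [Function.iterate_succ_apply']
    exact costAvg_antitone h0 h1 ih

theorem costAvg_le_costAvg (hlh : lo ≤ hi) {q' : ℝ} (hq : q ≤ q') {φ : ℝ → ℝ}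
    (hφ : Antitone φ) (z : ℝ) : costAvg lo hi q φ z ≤ costAvg lo hi q' φ z := by
  have : φ (z + hi) ≤ φ (z + lo) := hφ (by linarith)
  unfold costAvg
  nlinarith

theorem costAvg_iterate_mono (h0 : 0 ≤ q) (h1 : q ≤ 1) {φ ψ : ℝ → ℝ} (h : ∀ z, φ z ≤ ψ z)
    (k : ℕ) (z : ℝ) : (costAvg lo hi q)^[k] φ z ≤ (costAvg lo hi q)^[k] ψ z := by
  induction k generalizing z with
  | zero => exact h z
  | succ k ih =>
    rw [Function.iterate_succ_apply', Function.iterate_succ_apply']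
    exact add_le_add (mul_le_mul_of_nonneg_left (ih _) h0)
      (mul_le_mul_of_nonneg_left (ih _) (by linarith))

theorem le_costAvg_iterate_of_forall_le (hlh : lo ≤ hi) (h0 : 0 ≤ q) (h1 : q ≤ 1)
    {φ : ℝ → ℝ} {v : ℝ} (k : ℕ) (z : ℝ) (h : ∀ w ≤ z + k * hi, v ≤ φ w) :
    v ≤ (costAvg lo hi q)^[k] φ z := by
  induction k generalizing z with
  | zero => exact h z (by simp)
  | succ k ih =>
    rw [Function.iterate_succ_apply']
    have a1 := ih (z + lo) fun w hw => h w (by push_cast; linarith)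
    have a2 := ih (z + hi) fun w hw => h w (by push_cast; linarith)
    rw [costAvg]
    nlinarith

/-- The mean of `u - v * cost`. -/
theorem costAvg_iterate_affine (u v : ℝ) (k : ℕ) (z : ℝ) :
    (costAvg lo hi q)^[k] (fun w => u - v * w) z
      = u - v * (z + k * (q * lo + (1 - q) * hi)) := by
  induction k generalizing z with
  | zero => simp
  | succ k ih =>
    rw [Function.iterate_succ_apply']
    simp only [costAvg, ih]
    push_cast
    ring

end CostAvg

section TotalCost

theorem sum_update_insert {ι X : Type*} [DecidableEq ι] (f : X → ℝ) {i : ι} {a : Finset ι} (hi : i ∉ a)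
    (x : ι → X) (y : X) :
    ∑ j ∈ insert i a, f (Function.update x i y j) = f y + ∑ j ∈ a, f (x j) := by
  rw [Finset.sum_insert hi, Function.update_self]
  congr 1
  refine Finset.sum_congr rfl fun j hj => ?_
  rw [Function.update_of_ne]
  rintro rfl
  exact hi hj

variable {ι X : Type*} [Fintype ι] [DecidableEq ι] [Fintype X]
  {p : ι → X → ℝ} {cost : X → ℝ} {lo hi : ℝ} {m : ι → ℝ}

theorem prodExp_cost_le (hp0 : ∀ i y, 0 ≤ p i y) (hp : ∀ i, ∑ y, p i y = 1)
    (hm : ∀ i, ∀ φ : ℝ → ℝ, ∑ y, p i y * φ (cost y) = m i * φ lo + (1 - m i) * φ hi)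
    (hlh : lo ≤ hi) {q : ℝ} (h0 : 0 ≤ q) (h1 : q ≤ 1) {φ : ℝ → ℝ} (hφ : Antitone φ)
    (a : Finset ι) (ha : ∀ i ∈ a, m i ≤ q) (z : ℝ) :
    prodExp p (fun x => φ (z + ∑ i ∈ a, cost (x i))) ≤ (costAvg lo hi q)^[a.card] φ z := by
  induction a using Finset.induction_on generalizing z with
  | empty => simp [prodExp_const hp]
  | insert i a hi' ih =>
    rw [prodExp_update_self i (hp i), Finset.card_insert_of_notMem hi',
      Function.iterate_succ_apply']
    simp only [sum_update_insert cost hi', ← add_assoc]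
    have ih' := ih fun j hj => ha j (Finset.mem_insert_of_mem hj)
    calc _ ≤ ∑ y, p i y * (fun w => (costAvg lo hi q)^[a.card] φ (z + w)) (cost y) :=
          Finset.sum_le_sum fun y _ => mul_le_mul_of_nonneg_left (ih' _) (hp0 i y)
      _ = costAvg lo hi (m i) ((costAvg lo hi q)^[a.card] φ) z :=
          hm i fun w => (costAvg lo hi q)^[a.card] φ (z + w)
      _ ≤ _ := costAvg_le_costAvg hlh (ha i (Finset.mem_insert_self i a))
          (costAvg_iterate_antitone h0 h1 hφ _) z

theorem le_prodExp_cost (hp0 : ∀ i y, 0 ≤ p i y) (hp : ∀ i, ∑ y, p i y = 1)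
    (hm : ∀ i, ∀ φ : ℝ → ℝ, ∑ y, p i y * φ (cost y) = m i * φ lo + (1 - m i) * φ hi)
    (hlh : lo ≤ hi) {q : ℝ} (h0 : 0 ≤ q) (h1 : q ≤ 1) {φ : ℝ → ℝ} (hφ : Antitone φ)
    (a : Finset ι) (ha : ∀ i ∈ a, q ≤ m i) (z : ℝ) :
    (costAvg lo hi q)^[a.card] φ z ≤ prodExp p (fun x => φ (z + ∑ i ∈ a, cost (x i))) := by
  induction a using Finset.induction_on generalizing z with
  | empty => simp [prodExp_const hp]
  | insert i a hi' ih =>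
    rw [prodExp_update_self i (hp i), Finset.card_insert_of_notMem hi',
      Function.iterate_succ_apply']
    simp only [sum_update_insert cost hi', ← add_assoc]
    have ih' := ih fun j hj => ha j (Finset.mem_insert_of_mem hj)
    calc _ ≤ costAvg lo hi (m i) ((costAvg lo hi q)^[a.card] φ) z :=
          costAvg_le_costAvg hlh (ha i (Finset.mem_insert_self i a))
            (costAvg_iterate_antitone h0 h1 hφ _) z
      _ = ∑ y, p i y * (fun w => (costAvg lo hi q)^[a.card] φ (z + w)) (cost y) :=
          (hm i fun w => (costAvg lo hi q)^[a.card] φ (z + w)).symm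
      _ ≤ _ := Finset.sum_le_sum fun y _ => mul_le_mul_of_nonneg_left (ih' _) (hp0 i y)

theorem prodExp_cost_eq (hp0 : ∀ i y, 0 ≤ p i y) (hp : ∀ i, ∑ y, p i y = 1)
    (hm : ∀ i, ∀ φ : ℝ → ℝ, ∑ y, p i y * φ (cost y) = m i * φ lo + (1 - m i) * φ hi)
    (hlh : lo ≤ hi) {q : ℝ} (h0 : 0 ≤ q) (h1 : q ≤ 1) {φ : ℝ → ℝ} (hφ : Antitone φ)
    (a : Finset ι) (ha : ∀ i ∈ a, m i = q) :
    prodExp p (fun x => φ (∑ i ∈ a, cost (x i))) = (costAvg lo hi q)^[a.card] φ 0 := by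
  have h2 := prodExp_cost_le hp0 hp hm hlh h0 h1 hφ a (fun i hi => (ha i hi).le) 0
  have h3 := le_prodExp_cost hp0 hp hm hlh h0 h1 hφ a (fun i hi => (ha i hi).ge) 0
  simp only [zero_add] at h2 h3
  exact le_antisymm h2 h3

/-- A reward that is independent of the cost of the same arm is independent of the total cost. -/
theorem prodExp_reward_mul (hp : ∀ i, ∑ y, p i y = 1) {rew : X → ℝ} {i : ι} {r : ℝ}
    (hr : ∀ φ : ℝ → ℝ, ∑ y, p i y * (rew y * φ (cost y)) = r * ∑ y, p i y * φ (cost y))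
    {a : Finset ι} (hi : i ∈ a) (φ : ℝ → ℝ) :
    prodExp p (fun x => rew (x i) * φ (∑ j ∈ a, cost (x j)))
      = r * prodExp p (fun x => φ (∑ j ∈ a, cost (x j))) := by
  obtain ⟨a, hia, rfl⟩ : ∃ a', i ∉ a' ∧ insert i a' = a :=
    ⟨a.erase i, Finset.notMem_erase i a, Finset.insert_erase hi⟩
  rw [prodExp_update_self i (hp i), prodExp_update_self i (hp i) (fun x => φ _)]
  simp only [sum_update_insert cost hia, Function.update_self, prodExp_const_mul]
  exact hr fun w => prodExp p fun x => φ (w + ∑ j ∈ a, cost (x j))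

end TotalCost

/-! ### Planted environments with two cost values -/

/-- The bits of one arm in one round: reward bit and cheapness bit. -/
abbrev ArmBits : Type := Bool × Bool

def ArmBits.reward (y : ArmBits) : ℝ := if y.1 then 1 else 0

def ArmBits.cost (lo hi : ℝ) (y : ArmBits) : ℝ := if y.2 then lo else hi

/-- Weights of a coin that shows `true` with probability `q`. -/
def coin (q : ℝ) (b : Bool) : ℝ := if b then q else 1 - q

/-- Reward bit with probability `q`, and independently cheapness bit with probability `r`. -/
def armLaw (q r : ℝ) (y : ArmBits) : ℝ := coin q y.1 * coin r y.2

/-- The law of one round: biases `ε` and `δ` for the arms in `s`, fair bits for the others. -/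
def roundLaw {N : ℕ} (ε δ : ℝ) (s : Finset (Fin N)) (i : Fin N) : ArmBits → ℝ :=
  armLaw (if i ∈ s then 1 / 2 + ε else 1 / 2) (if i ∈ s then 1 / 2 + δ else 1 / 2)

def setCost {N : ℕ} (lo hi : ℝ) (a : Finset (Fin N)) (x : Fin N → ArmBits) : ℝ :=
  ∑ i ∈ a, (x i).cost lo hi

def setReward {N : ℕ} (a : Finset (Fin N)) (x : Fin N → ArmBits) : ℝ :=
  ∑ i ∈ a, (x i).reward

/-- The observation when `a` is played and the bits of the round are `x`. -/
def observeBits {N K : ℕ} (lo hi : ℝ) (a : Arms N K) (x : Fin N → ArmBits) : Observation N K :=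
  ⟨a, fun i => (x i).reward, fun i => (x i).cost lo hi⟩

/-- The environment encoded by `ω`, with costs `lo` and `hi`. -/
def twoCostEnvironment {N : ℕ} (lo hi : ℝ) (ω : Bits N) : Environment N where
  reward t i := ArmBits.reward (ω (t, i))
  cost t i := ArmBits.cost lo hi (ω (t, i))

theorem twoCostEnvironment_isAdmissible {N : ℕ} {c lo hi : ℝ} (hlo : c ≤ lo) (hlh : lo ≤ hi)
    (hhi : hi ≤ 1) (ω : Bits N) : (twoCostEnvironment lo hi ω).IsAdmissible c where
  reward_mem t i := by
    simp only [twoCostEnvironment, ArmBits.reward]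
    split_ifs <;> simp
  cost_mem t i := by
    simp only [twoCostEnvironment, ArmBits.cost]
    split_ifs
    · exact ⟨hlo, hlh.trans hhi⟩
    · exact ⟨hlo.trans hlh, hhi⟩

theorem coin_nonneg {q : ℝ} (h0 : 0 ≤ q) (h1 : q ≤ 1) (b : Bool) : 0 ≤ coin q b := by
  unfold coin
  split_ifs <;> linarith

theorem armLaw_nonneg {q r : ℝ} (hq0 : 0 ≤ q) (hq1 : q ≤ 1) (hr0 : 0 ≤ r) (hr1 : r ≤ 1)
    (y : ArmBits) : 0 ≤ armLaw q r y :=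
  mul_nonneg (coin_nonneg hq0 hq1 _) (coin_nonneg hr0 hr1 _)

theorem sum_armLaw (q r : ℝ) : ∑ y, armLaw q r y = 1 := by
  simp [Fintype.sum_prod_type, armLaw, coin]
  ring

theorem sum_armLaw_cost (q r lo hi : ℝ) (φ : ℝ → ℝ) :
    ∑ y : ArmBits, armLaw q r y * φ (y.cost lo hi) = r * φ lo + (1 - r) * φ hi := by
  simp [Fintype.sum_prod_type, armLaw, coin, ArmBits.cost]
  ring

theorem sum_armLaw_reward_cost (q r lo hi : ℝ) (φ : ℝ → ℝ) :
    ∑ y : ArmBits, armLaw q r y * (y.reward * φ (y.cost lo hi))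
      = q * ∑ y : ArmBits, armLaw q r y * φ (y.cost lo hi) := by
  simp [Fintype.sum_prod_type, armLaw, coin, ArmBits.cost, ArmBits.reward]
  ring

section RoundLaw

variable {N : ℕ} {ε δ : ℝ}

theorem roundLaw_nonneg (hε0 : 0 ≤ ε) (hε1 : ε ≤ 1 / 2) (hδ0 : 0 ≤ δ) (hδ1 : δ ≤ 1 / 2)
    (s : Finset (Fin N)) (i : Fin N) (y : ArmBits) : 0 ≤ roundLaw ε δ s i y := by
  unfold roundLaw
  split_ifs <;> apply armLaw_nonneg <;> linarith

theorem sum_roundLaw (s : Finset (Fin N)) (i : Fin N) : ∑ y, roundLaw ε δ s i y = 1 :=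
  sum_armLaw _ _

theorem sum_roundLaw_cost (s : Finset (Fin N)) (lo hi : ℝ) (i : Fin N) (φ : ℝ → ℝ) :
    ∑ y : ArmBits, roundLaw ε δ s i y * φ (y.cost lo hi)
      = (if i ∈ s then 1 / 2 + δ else 1 / 2) * φ lo
        + (1 - if i ∈ s then 1 / 2 + δ else 1 / 2) * φ hi :=
  sum_armLaw_cost _ _ _ _ _

/-- Expected reward of the arms in `a` on an event that only depends on their total cost. -/
theorem prodExp_setReward_mul (s a : Finset (Fin N)) (lo hi : ℝ) (φ : ℝ → ℝ) :
    prodExp (roundLaw ε δ s) (fun x => setReward a x * φ (setCost lo hi a x))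
      = (a.card / 2 + ε * (a ∩ s).card)
        * prodExp (roundLaw ε δ s) (fun x => φ (setCost lo hi a x)) := by
  simp only [setReward, Finset.sum_mul]
  rw [prodExp_sum]
  have h : ∀ i ∈ a, prodExp (roundLaw ε δ s)
      (fun x => (x i).reward * φ (setCost lo hi a x))
      = (1 / 2 + if i ∈ s then ε else 0)
        * prodExp (roundLaw ε δ s) (fun x => φ (setCost lo hi a x)) := by
    intro i hi'
    refine (prodExp_reward_mul (cost := ArmBits.cost lo hi) (rew := ArmBits.reward)
      (r := if i ∈ s then 1 / 2 + ε else 1 / 2) (sum_roundLaw s)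
      (fun ψ => sum_armLaw_reward_cost _ _ lo hi ψ) hi' φ).trans ?_
    congr 1
    split_ifs <;> ring
  rw [Finset.sum_congr rfl h, ← Finset.sum_mul, Finset.sum_add_distrib, Finset.sum_const,
    ← Finset.sum_filter, Finset.sum_const, Finset.filter_mem_eq_inter, nsmul_eq_mul, nsmul_eq_mul]
  ring

/-- Only the laws of the arms that are played matter. -/
theorem prodExp_roundLaw_inter (s a : Finset (Fin N)) {F : (Fin N → ArmBits) → ℝ}
    (hF : ∀ i ∉ a, ∀ x y, F (Function.update x i y) = F x) :
    prodExp (roundLaw ε δ s) F = prodExp (roundLaw ε δ (a ∩ s)) F := by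
  refine prodExp_congr_law (sum_roundLaw s) (sum_roundLaw _) (a := a) (fun i hi => ?_) hF
  simp [roundLaw, hi]

theorem setCost_update_of_notMem {a : Finset (Fin N)} {i : Fin N} (hi' : i ∉ a) (lo hi : ℝ)
    (x : Fin N → ArmBits) (y : ArmBits) :
    setCost lo hi a (Function.update x i y) = setCost lo hi a x := by
  refine Finset.sum_congr rfl fun j hj => ?_
  rw [Function.update_of_ne]
  rintro rfl
  exact hi' hj

theorem setReward_update_of_notMem {a : Finset (Fin N)} {i : Fin N} (hi' : i ∉ a)
    (x : Fin N → ArmBits) (y : ArmBits) :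
    setReward a (Function.update x i y) = setReward a x := by
  refine Finset.sum_congr rfl fun j hj => ?_
  rw [Function.update_of_ne]
  rintro rfl
  exact hi' hj

theorem observeBits_update_of_notMem {K : ℕ} {a : Arms N K} {i : Fin N} (hi' : i ∉ a.1)
    (lo hi : ℝ) (x : Fin N → ArmBits) (y : ArmBits) :
    observeBits lo hi a (Function.update x i y) = observeBits lo hi a x := by
  have h : ∀ j : a.1, Function.update x i y j = x j := fun j =>
    Function.update_of_ne (by rintro rfl; exact hi' j.2) _ _
  simp [observeBits, h]

end RoundLaw

/-! ### The game averaged over the random environment -/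

/-- The expected total payoff of the next at most `n` rounds, when the arms in `s` are good, the
history is `h`, the remaining budget is `b`, and a round that is paid for yields `r`. -/
def plantedValue {N K : ℕ} (π : Policy N K) (lo hi ε δ : ℝ) (s : Finset (Fin N))
    (r : Arms N K → (Fin N → ArmBits) → ℝ) : ℕ → List (Observation N K) → ℝ → ℝ
  | 0, _, _ => 0
  | n + 1, h, b =>
      ∑ a : Arms N K, (π h a).toReal * prodExp (roundLaw ε δ (a.1 ∩ s)) (fun x =>
        if setCost lo hi a.1 x ≤ b then
          r a x + plantedValue π lo hi ε δ s r n (observeBits lo hi a x :: h)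
            (b - setCost lo hi a.1 x)
        else 0)

section Law

open MeasureTheory ProbabilityTheory

variable {N K : ℕ}

/-- All bits are independent; the reward bits have bias `ε` and the cheapness bits bias `δ` for
the arms in `s`. -/
def twoBiasLaw (ε δ : ℝ) (s : Finset (Fin N)) : Measure (Bits N) :=
  Measure.infinitePi fun j : ℕ × Fin N =>
    (bernoulliMeasure true false (bitProb ε s j.2)).prod
      (bernoulliMeasure true false (bitProb δ s j.2))

instance (ε δ : ℝ) (s : Finset (Fin N)) : IsProbabilityMeasure (twoBiasLaw ε δ s) := by
  unfold twoBiasLaw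
  infer_instance

theorem bernoulliMeasure_real_singleton {q : ℝ} (h0 : 0 ≤ q) (h1 : q ≤ 1) (b : Bool) :
    (bernoulliMeasure true false (Set.projIcc (0 : ℝ) 1 zero_le_one q)).real {b} = coin q b := by
  rw [Set.projIcc_of_mem zero_le_one ⟨h0, h1⟩,
    bernoulliMeasure_real_apply _ (measurableSet_singleton b)]
  cases b <;> simp [coin]

/-- A function of finitely many bits is a measurable function of these bits. -/
theorem exists_measurable_of_dependsOn {f : Bits N → ℝ} {J : Finset (ℕ × Fin N)}
    (hf : DependsOn f (J : Set (ℕ × Fin N))) :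
    ∃ g : (J → ArmBits) → ℝ, Measurable g ∧ f = g ∘ (fun ω (j : J) => ω j) := by
  classical
  refine ⟨fun y => f (fun j => if hj : j ∈ J then y ⟨j, hj⟩ else default), ?_, ?_⟩
  · exact measurable_of_finite _
  · funext ω
    refine hf fun j hj => ?_
    have hj : j ∈ J := hj
    simp [hj]

theorem integrable_of_dependsOn {f : Bits N → ℝ} {J : Finset (ℕ × Fin N)}
    (hf : DependsOn f (J : Set (ℕ × Fin N))) (μ : Measure (Bits N)) [IsFiniteMeasure μ] :
    Integrable f μ := by
  obtain ⟨g, hg, rfl⟩ := exists_measurable_of_dependsOn hf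
  obtain ⟨C, hC⟩ := (Set.finite_range fun y => ‖g y‖).bddAbove
  refine Integrable.of_bound (C := C) (Measurable.aestronglyMeasurable (by fun_prop)) ?_
  exact Filter.Eventually.of_forall fun ω => hC ⟨_, rfl⟩

theorem twoBiasLaw_real_round {ε δ : ℝ} (hε0 : 0 ≤ ε) (hε1 : ε ≤ 1 / 2) (hδ0 : 0 ≤ δ)
    (hδ1 : δ ≤ 1 / 2) (s : Finset (Fin N)) (t : ℕ) (x : Fin N → ArmBits) :
    (twoBiasLaw ε δ s).real {ω | ∀ i, ω (t, i) = x i} = ∏ i, roundLaw ε δ s i (x i) := by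
  classical
  have hset : {ω : Bits N | ∀ i, ω (t, i) = x i}
      = Set.pi ((Finset.univ.image fun i : Fin N => (t, i)) : Finset (ℕ × Fin N))
          (fun j => {x j.2}) := by
    ext ω
    simp
  rw [hset, measureReal_def, twoBiasLaw,
    Measure.infinitePi_pi _ (fun _ _ => measurableSet_singleton _), Finset.prod_image (fun i _ j _ hij => (Prod.mk.inj hij).2), ENNReal.toReal_prod]
  refine Finset.prod_congr rfl fun i _ => ?_
  rw [← Set.singleton_prod_singleton, Measure.prod_prod, ENNReal.toReal_mul]
  refine congrArg₂ (· * ·) (bernoulliMeasure_real_singleton ?_ ?_ _)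
    (bernoulliMeasure_real_singleton ?_ ?_ _) <;> split_ifs <;> linarith

/-- The rounds are independent. -/
theorem integral_round {ε δ : ℝ} (hε0 : 0 ≤ ε) (hε1 : ε ≤ 1 / 2) (hδ0 : 0 ≤ δ)
    (hδ1 : δ ≤ 1 / 2) (s : Finset (Fin N)) (t : ℕ) {J : Finset (ℕ × Fin N)}
    (hJ : ∀ j ∈ J, t < j.1) {G : (Fin N → ArmBits) → Bits N → ℝ}
    (hG : ∀ x, DependsOn (G x) (J : Set (ℕ × Fin N))) :
    ∫ ω, G (fun i => ω (t, i)) ω ∂(twoBiasLaw ε δ s)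
      = prodExp (roundLaw ε δ s) (fun x => ∫ ω, G x ω ∂(twoBiasLaw ε δ s)) := by
  classical
  set μ := twoBiasLaw ε δ s with hμ
  let R : Finset (ℕ × Fin N) := Finset.univ.image fun i : Fin N => (t, i)
  let A : (Fin N → ArmBits) → Set (Bits N) := fun x => {ω | ∀ i, ω (t, i) = x i}
  have hdecomp : ∀ ω, G (fun i => ω (t, i)) ω = ∑ x, (A x).indicator 1 ω * G x ω := by
    intro ω
    rw [Finset.sum_eq_single (fun i => ω (t, i))]
    · simp [A]
    · intro x _ hx
      rw [Set.indicator_of_notMem, zero_mul]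
      intro h
      exact hx (funext fun i => (h i).symm)
    · simp
  have hind : ∀ x, DependsOn ((A x).indicator (1 : Bits N → ℝ)) (R : Set (ℕ × Fin N)) := by
    intro x ω ω' h
    have : ω ∈ A x ↔ ω' ∈ A x := by
      refine forall_congr' fun i => ?_
      rw [h (t, i) (by simp [R])]
    simp only [Set.indicator, this, Pi.one_apply]
  have hprod : ∀ x, ∫ ω, (A x).indicator 1 ω * G x ω ∂μ
      = (∏ i, roundLaw ε δ s i (x i)) * ∫ ω, G x ω ∂μ := by
    intro x
    obtain ⟨g, hg, hgi⟩ := exists_measurable_of_dependsOn (hind x)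
    obtain ⟨k, hk, hki⟩ := exists_measurable_of_dependsOn (hG x)
    have hI : IndepFun (fun (ω : Bits N) (j : R) => ω j) (fun (ω : Bits N) (j : J) => ω j) μ := by
      refine iIndepFun.indepFun_finset (f := fun (j : ℕ × Fin N) (ω : Bits N) => ω j) R J ?_ ?_ ?_
      · rw [Finset.disjoint_left]
        intro j hj hj'
        obtain ⟨i, -, rfl⟩ := Finset.mem_image.1 hj
        exact lt_irrefl _ (hJ _ hj')
      · exact iIndepFun_infinitePi (X := fun _ y => y) (by fun_prop)
      · fun_prop
    have hI' := hI.comp hg hk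
    rw [← hgi, ← hki] at hI'
    have hm1 : Measurable ((A x).indicator (1 : Bits N → ℝ)) := by
      rw [hgi]; fun_prop
    have hm2 : Measurable (G x) := by
      rw [hki]; fun_prop
    rw [hI'.integral_fun_mul_eq_mul_integral hm1.aestronglyMeasurable hm2.aestronglyMeasurable,
      ← twoBiasLaw_real_round hε0 hε1 hδ0 hδ1 s t x]
    congr 1
    have hA : MeasurableSet (A x) := by
      have : A x = (A x).indicator (1 : Bits N → ℝ) ⁻¹' {1} := by
        ext ω
        simp [Set.indicator]
      rw [this]
      exact hm1 (measurableSet_singleton _)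
    exact integral_indicator_one hA
  calc ∫ ω, G (fun i => ω (t, i)) ω ∂μ = ∫ ω, ∑ x, (A x).indicator 1 ω * G x ω ∂μ := by
        simp only [hdecomp]
    _ = ∑ x, ∫ ω, (A x).indicator 1 ω * G x ω ∂μ := by
        refine integral_finsetSum _ fun x _ => ?_
        refine integrable_of_dependsOn (J := R ∪ J) ?_ μ
        intro ω ω' h
        simp only
        rw [hind x fun j hj => h j (by simp at hj ⊢; exact Or.inl hj),
          hG x fun j hj => h j (by simp at hj ⊢; exact Or.inr hj)]
    _ = _ := by simp only [hprod]; rfl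

/-- The bits of the `n` rounds from round `t` on. -/
def roundBlock (N t n : ℕ) : Finset (ℕ × Fin N) := Finset.Ico t (t + n) ×ˢ Finset.univ

theorem gainWithin_dependsOn (π : Policy N K) (lo hi : ℝ) (n : ℕ)
    (h : List (Observation N K)) (b : ℝ) :
    DependsOn (fun ω => gainWithin π (twoCostEnvironment lo hi ω) n h b)
      (roundBlock N h.length n : Set (ℕ × Fin N)) := by
  induction n generalizing h b with
  | zero =>
    intro ω ω' _
    rfl
  | succ n ih =>
    intro ω ω' hω
    have h1 : ∀ i, ω (h.length, i) = ω' (h.length, i) := fun i =>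
      hω _ (by simp [roundBlock])
    have hobs : ∀ a : Arms N K, (twoCostEnvironment lo hi ω).observe h.length a
        = (twoCostEnvironment lo hi ω').observe h.length a := fun a => by
      simp [Environment.observe, twoCostEnvironment, h1]
    have hc : ∀ a : Arms N K, (twoCostEnvironment lo hi ω).roundCost h.length a
        = (twoCostEnvironment lo hi ω').roundCost h.length a := fun a => by
      simp [Environment.roundCost, twoCostEnvironment, h1]
    have hr : ∀ a : Arms N K, (twoCostEnvironment lo hi ω).roundReward h.length a
        = (twoCostEnvironment lo hi ω').roundReward h.length a := fun a => by
      simp [Environment.roundReward, twoCostEnvironment, h1]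
    simp only [gainWithin, hobs, hc, hr]
    refine Finset.sum_congr rfl fun a _ => ?_
    have := ih ((twoCostEnvironment lo hi ω').observe h.length a :: h)
      (b - (twoCostEnvironment lo hi ω').roundCost h.length a) (x := ω) (y := ω')
      fun j hj => hω j (by
        simp only [roundBlock, List.length_cons, Finset.coe_product, Finset.coe_Ico,
          Finset.coe_univ, Set.mem_prod, Set.mem_Ico, Set.mem_univ, and_true] at hj ⊢
        omega)
    simp only at this
    rw [this]

theorem integrable_gainWithin (π : Policy N K) (lo hi : ℝ) (n : ℕ)
    (h : List (Observation N K)) (b : ℝ) (μ : Measure (Bits N)) [IsFiniteMeasure μ] :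
    Integrable (fun ω => gainWithin π (twoCostEnvironment lo hi ω) n h b) μ :=
  integrable_of_dependsOn (gainWithin_dependsOn π lo hi n h b) μ

theorem integrable_weakRegret (π : Policy N K) (lo hi c B : ℝ) (μ : Measure (Bits N))
    [IsFiniteMeasure μ] :
    Integrable (fun ω => weakRegret π (twoCostEnvironment lo hi ω) c B) μ := by
  refine integrable_of_dependsOn (J := roundBlock N 0 (maxRounds K c B)) ?_ μ
  intro ω ω' h
  have key : ∀ π' : Policy N K, expectedGain π' (twoCostEnvironment lo hi ω) c B
      = expectedGain π' (twoCostEnvironment lo hi ω') c B := fun π' =>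
    gainWithin_dependsOn π' lo hi _ [] B h
  simp only [weakRegret, key]

/-- The expected gain in the random environment. -/
theorem integral_gainWithin (π : Policy N K) (lo hi : ℝ) {ε δ : ℝ} (hε0 : 0 ≤ ε)
    (hε1 : ε ≤ 1 / 2) (hδ0 : 0 ≤ δ) (hδ1 : δ ≤ 1 / 2) (s : Finset (Fin N)) (n : ℕ)
    (h : List (Observation N K)) (b : ℝ) :
    ∫ ω, gainWithin π (twoCostEnvironment lo hi ω) n h b ∂(twoBiasLaw ε δ s)
      = plantedValue π lo hi ε δ s (fun a x => setReward a.1 x) n h b := by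
  induction n generalizing h b with
  | zero => simp [gainWithin, plantedValue]
  | succ n ih =>
    let G : Arms N K → (Fin N → ArmBits) → Bits N → ℝ := fun a x ω =>
      if setCost lo hi a.1 x ≤ b then
        setReward a.1 x + gainWithin π (twoCostEnvironment lo hi ω) n
          (observeBits lo hi a x :: h) (b - setCost lo hi a.1 x)
      else 0
    have hG : ∀ a x, DependsOn (G a x) (roundBlock N (h.length + 1) n : Set (ℕ × Fin N)) := by
      intro a x ω ω' hω
      simp only [G]
      have := gainWithin_dependsOn π lo hi n (observeBits lo hi a x :: h)
        (b - setCost lo hi a.1 x) hω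
      simp only at this
      rw [this]
    have hstep : ∀ ω, gainWithin π (twoCostEnvironment lo hi ω) (n + 1) h b
        = ∑ a : Arms N K, (π h a).toReal * G a (fun i => ω (h.length, i)) ω := fun ω => rfl
    have hint : ∀ a : Arms N K, Integrable (fun ω => G a (fun i => ω (h.length, i)) ω)
        (twoBiasLaw ε δ s) := by
      intro a
      refine integrable_of_dependsOn (J := roundBlock N h.length (n + 1)) ?_ _
      intro ω ω' hω
      have h1 : (fun i => ω (h.length, i)) = fun i => ω' (h.length, i) :=
        funext fun i => hω _ (by simp [roundBlock])
      simp only [h1]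
      refine hG a _ fun j hj => hω j ?_
      simp only [roundBlock, Finset.coe_product, Finset.coe_Ico,
        Finset.coe_univ, Set.mem_prod, Set.mem_Ico, Set.mem_univ, and_true] at hj ⊢
      omega
    simp only [hstep]
    rw [integral_finsetSum _ fun a _ => (hint a).const_mul _, plantedValue]
    refine Finset.sum_congr rfl fun a _ => ?_
    rw [integral_const_mul, integral_round hε0 hε1 hδ0 hδ1 s h.length (fun j hj => by
      simp only [roundBlock, Finset.mem_product, Finset.mem_Ico] at hj
      omega) (hG a)]
    congr 1
    have hval : ∀ x, ∫ ω, G a x ω ∂(twoBiasLaw ε δ s) = if setCost lo hi a.1 x ≤ b then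
        setReward a.1 x + plantedValue π lo hi ε δ s (fun a x => setReward a.1 x) n
          (observeBits lo hi a x :: h) (b - setCost lo hi a.1 x) else 0 := by
      intro x
      simp only [G]
      split_ifs
      · rw [integral_add (integrable_const _) (integrable_gainWithin _ _ _ _ _ _ _), ih]
        simp
      · simp
    simp only [hval]
    refine prodExp_roundLaw_inter s a.1 fun i hi' x y => ?_
    rw [setCost_update_of_notMem hi', setReward_update_of_notMem hi',
      observeBits_update_of_notMem hi']

end Law

/-! ### The expected number of rounds that the budget pays for -/

/-- The expected number of rounds, at most `n`, that the budget `b` pays for, when in every round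
`K` arms are played whose costs are `lo` with probability `q` and `hi` otherwise. -/
def paidRounds (lo hi q : ℝ) (K : ℕ) : ℕ → ℝ → ℝ
  | 0, _ => 0
  | n + 1, b =>
      (costAvg lo hi q)^[K] (fun z => if z ≤ b then 1 + paidRounds lo hi q K n (b - z) else 0) 0

section PaidRounds

variable {lo hi q : ℝ} {K : ℕ}

theorem paidRounds_nonneg (h0 : 0 ≤ q) (h1 : q ≤ 1) (hlh : lo ≤ hi) (n : ℕ) (b : ℝ) :
    0 ≤ paidRounds lo hi q K n b := by
  induction n generalizing b with
  | zero => exact le_rfl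
  | succ n ih =>
    rw [paidRounds]
    refine le_costAvg_iterate_of_forall_le hlh h0 h1 K 0 fun w _ => ?_
    split_ifs
    · linarith [ih (b - w)]
    · exact le_rfl

theorem paidRounds_mono (h0 : 0 ≤ q) (h1 : q ≤ 1) (hlh : lo ≤ hi) (n : ℕ) :
    Monotone (paidRounds lo hi q K n) := by
  induction n with
  | zero => exact fun _ _ _ => le_rfl
  | succ n ih =>
    intro b b' hb
    rw [paidRounds, paidRounds]
    refine costAvg_iterate_mono h0 h1 (fun z => ?_) K 0
    have h2 := paidRounds_nonneg (K := K) h0 h1 hlh n (b' - z)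
    split_ifs with h3 h4
    · have := ih (show b - z ≤ b' - z by linarith)
      linarith
    · exact absurd (h3.trans hb) h4
    · linarith
    · exact le_rfl

theorem antitone_one_add_paidRounds (h0 : 0 ≤ q) (h1 : q ≤ 1) (hlh : lo ≤ hi) (n : ℕ) (b : ℝ) :
    Antitone fun z => if z ≤ b then 1 + paidRounds lo hi q K n (b - z) else 0 := by
  intro z z' hz
  have h2 := paidRounds_nonneg (K := K) h0 h1 hlh n (b - z)
  simp only
  split_ifs with h3 h4
  · have := paidRounds_mono (K := K) h0 h1 hlh n (show b - z' ≤ b - z by linarith)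
    linarith
  · exact absurd (hz.trans h3) h4
  · linarith
  · exact le_rfl

/-- A budget that pays for `j` rounds at the highest price pays for `j` rounds. -/
theorem le_paidRounds (h0 : 0 ≤ q) (h1 : q ≤ 1) (hlh : lo ≤ hi) (hhi : 0 ≤ hi) {n j : ℕ}
    (hjn : j ≤ n) {b : ℝ} (hb : j * (K * hi) ≤ b) : (j : ℝ) ≤ paidRounds lo hi q K n b := by
  induction j generalizing n b with
  | zero => simpa using paidRounds_nonneg h0 h1 hlh n b
  | succ j ih =>
    obtain ⟨n, rfl⟩ : ∃ n', n = n' + 1 := ⟨n - 1, by omega⟩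
    rw [paidRounds]
    refine le_costAvg_iterate_of_forall_le hlh h0 h1 K 0 fun w hw => ?_
    push_cast at hb ⊢
    have h2 : 0 ≤ (j : ℝ) * (K * hi) := by positivity
    rw [if_pos (by nlinarith)]
    have := ih (n := n) (b := b - w) (by omega) (by nlinarith)
    linarith

/-- Wald's identity: `n + 1` rounds exhaust the budget. -/
theorem le_meanCost_mul_paidRounds (h0 : 0 ≤ q) (h1 : q ≤ 1) (hlo : 0 ≤ lo) (hlh : lo ≤ hi)
    (n : ℕ) {b : ℝ} (hb : b < (n + 1) * (K * lo)) :
    b ≤ K * (q * lo + (1 - q) * hi) * (paidRounds lo hi q K n b + 1) := by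
  set C := K * (q * lo + (1 - q) * hi) with hC
  have hlC : K * lo ≤ C := by
    rw [hC]
    refine mul_le_mul_of_nonneg_left ?_ (Nat.cast_nonneg K)
    nlinarith
  have hC0 : 0 ≤ C := le_trans (by positivity) hlC
  induction n generalizing b with
  | zero =>
    simp only [paidRounds, CharP.cast_eq_zero, zero_add, one_mul, mul_one] at hb ⊢
    linarith
  | succ n ih =>
    rcases hC0.eq_or_lt with hC0 | hC0
    · rw [← hC0, zero_mul]
      have : (K : ℝ) * lo = 0 := le_antisymm (by linarith) (by positivity)
      rw [this] at hb
      linarith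
    have key : ∀ z ≥ 0 + K * lo, b / C - 1 - 1 / C * (z - C) ≤
        if z ≤ b then 1 + paidRounds lo hi q K n (b - z) else 0 := by
      intro z hz
      have e : b / C - 1 - 1 / C * (z - C) = (b - z) / C := by field_simp; ring
      rw [e]
      split_ifs with h2
      · have := ih (b := b - z) (by push_cast at hb; linarith)
        rw [div_le_iff₀ hC0]
        linarith
      · exact div_nonpos_of_nonpos_of_nonneg (by linarith) hC0.le
    have mono : ∀ (φ ψ : ℝ → ℝ) (k : ℕ) (z : ℝ), (∀ w ≥ z + k * lo, φ w ≤ ψ w) →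
        (costAvg lo hi q)^[k] φ z ≤ (costAvg lo hi q)^[k] ψ z := by
      intro φ ψ k
      induction k with
      | zero => exact fun z h => h z (by simp)
      | succ k ihk =>
        intro z h
        rw [Function.iterate_succ_apply', Function.iterate_succ_apply']
        refine add_le_add
          (mul_le_mul_of_nonneg_left (ihk _ fun w hw => h w ?_) h0)
          (mul_le_mul_of_nonneg_left (ihk _ fun w hw => h w ?_) (by linarith)) <;>
        push_cast <;> linarith
    have h3 := mono _ _ K 0 key
    have e2 : (fun z => b / C - 1 - 1 / C * (z - C)) = fun z => b / C - 1 / C * z := by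
      funext z
      field_simp
      ring
    rw [e2, costAvg_iterate_affine, ← hC] at h3
    have e3 : b / C - 1 / C * (0 + C) = b / C - 1 := by field_simp; ring
    rw [e3] at h3
    have h4 : b / C ≤ paidRounds lo hi q K (n + 1) b + 1 := by
      rw [paidRounds]
      linarith
    rw [div_le_iff₀ hC0] at h4
    linarith

end PaidRounds

/-! ### Gains in terms of numbers of rounds -/

section Values

variable {N K : ℕ} {lo hi ε δ : ℝ}

theorem sum_policy (π : Policy N K) (h : List (Observation N K)) :
    ∑ a, (π h a).toReal = 1 := by
  have h1 := (π h).tsum_coe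
  rw [tsum_fintype] at h1
  rw [← ENNReal.toReal_sum fun a _ => (π h).apply_ne_top a, h1, ENNReal.toReal_one]

/-- The probability that `K` fair arms cost at most `b`. -/
def affordProb (lo hi : ℝ) (K : ℕ) (b : ℝ) : ℝ :=
  (costAvg lo hi (1 / 2))^[K] (fun z => if z ≤ b then 1 else 0) 0

theorem antitone_indicator_le (b : ℝ) : Antitone fun z : ℝ => if z ≤ b then (1 : ℝ) else 0 := by
  intro z z' hz
  simp only
  split_ifs with h1 h2
  · exact le_rfl
  · exact absurd (hz.trans h1) h2
  · exact zero_le_one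
  · exact le_rfl

theorem affordProb_nonneg (hlh : lo ≤ hi) (b : ℝ) : 0 ≤ affordProb lo hi K b :=
  le_costAvg_iterate_of_forall_le hlh (by norm_num) (by norm_num) K 0 fun w _ => by
    split_ifs <;> norm_num

theorem affordProb_le_one (b : ℝ) : affordProb lo hi K b ≤ 1 := by
  have h := costAvg_iterate_mono (lo := lo) (hi := hi) (q := 1 / 2) (by norm_num) (by norm_num)
    (φ := fun z => if z ≤ b then 1 else 0) (ψ := fun z => 1 - 0 * z)
    (fun z => by split_ifs <;> norm_num) K 0
  rw [costAvg_iterate_affine] at h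
  simpa [affordProb] using h

theorem roundLaw_cheap_le (hδ0 : 0 ≤ δ) (s : Finset (Fin N)) (i : Fin N) :
    (if i ∈ s then 1 / 2 + δ else 1 / 2 : ℝ) ≤ 1 / 2 + δ := by
  split_ifs <;> linarith

theorem le_roundLaw_cheap (hδ0 : 0 ≤ δ) (s : Finset (Fin N)) (i : Fin N) :
    (1 / 2 : ℝ) ≤ if i ∈ s then 1 / 2 + δ else 1 / 2 := by
  split_ifs <;> linarith

theorem affordProb_le_prodExp (hlh : lo ≤ hi) (hε0 : 0 ≤ ε) (hε1 : ε ≤ 1 / 2) (hδ0 : 0 ≤ δ)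
    (hδ1 : δ ≤ 1 / 2) (s : Finset (Fin N)) (a : Arms N K) (b : ℝ) :
    affordProb lo hi K b
      ≤ prodExp (roundLaw ε δ s) (fun x => if setCost lo hi a.1 x ≤ b then 1 else 0) := by
  have h := le_prodExp_cost (roundLaw_nonneg hε0 hε1 hδ0 hδ1 s) (sum_roundLaw s)
    (fun i φ => sum_roundLaw_cost s lo hi i φ) hlh (q := 1 / 2) (by norm_num) (by norm_num)
    (antitone_indicator_le b) a.1 (fun i _ => le_roundLaw_cheap hδ0 s i) 0
  rw [a.2] at h
  simp only [zero_add] at h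
  exact h

theorem prodExp_fair_cost (hlh : lo ≤ hi) (hε0 : 0 ≤ ε) (hε1 : ε ≤ 1 / 2) (hδ0 : 0 ≤ δ)
    (hδ1 : δ ≤ 1 / 2) (a : Arms N K) {φ : ℝ → ℝ} (hφ : Antitone φ) :
    prodExp (roundLaw ε δ ∅) (fun x => φ (setCost lo hi a.1 x))
      = (costAvg lo hi (1 / 2))^[K] φ 0 := by
  have h := prodExp_cost_eq (roundLaw_nonneg hε0 hε1 hδ0 hδ1 ∅) (sum_roundLaw ∅)
    (fun i φ => sum_roundLaw_cost ∅ lo hi i φ) hlh (q := 1 / 2) (by norm_num) (by norm_num)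
    hφ a.1 (by simp)
  rwa [a.2] at h

theorem prodExp_good_cost (hlh : lo ≤ hi) (hε0 : 0 ≤ ε) (hε1 : ε ≤ 1 / 2) (hδ0 : 0 ≤ δ)
    (hδ1 : δ ≤ 1 / 2) (a : Arms N K) {φ : ℝ → ℝ} (hφ : Antitone φ) :
    prodExp (roundLaw ε δ a.1) (fun x => φ (setCost lo hi a.1 x))
      = (costAvg lo hi (1 / 2 + δ))^[K] φ 0 := by
  have h := prodExp_cost_eq (roundLaw_nonneg hε0 hε1 hδ0 hδ1 a.1) (sum_roundLaw a.1)
    (fun i φ => sum_roundLaw_cost a.1 lo hi i φ) hlh (q := 1 / 2 + δ) (by linarith) (by linarith)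
    hφ a.1 (fun i hi' => by simp [hi'])
  rwa [a.2] at h

theorem prodExp_cost_le_good (hlh : lo ≤ hi) (hε0 : 0 ≤ ε) (hε1 : ε ≤ 1 / 2) (hδ0 : 0 ≤ δ)
    (hδ1 : δ ≤ 1 / 2) (s : Finset (Fin N)) (a : Arms N K) {φ : ℝ → ℝ} (hφ : Antitone φ) :
    prodExp (roundLaw ε δ s) (fun x => φ (setCost lo hi a.1 x))
      ≤ (costAvg lo hi (1 / 2 + δ))^[K] φ 0 := by
  have h := prodExp_cost_le (roundLaw_nonneg hε0 hε1 hδ0 hδ1 s) (sum_roundLaw s)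
    (fun i φ => sum_roundLaw_cost s lo hi i φ) hlh (q := 1 / 2 + δ) (by linarith) (by linarith)
    hφ a.1 (fun i _ => roundLaw_cheap_le hδ0 s i) 0
  rw [a.2] at h
  simp only [zero_add] at h
  exact h

/-- In the reward of a paid round, the reward bits may be replaced by their means. -/
theorem prodExp_ite_setReward_add (s : Finset (Fin N)) (a : Arms N K) (b : ℝ)
    (V : (Fin N → ArmBits) → ℝ) :
    prodExp (roundLaw ε δ (a.1 ∩ s))
        (fun x => if setCost lo hi a.1 x ≤ b then setReward a.1 x + V x else 0)
      = prodExp (roundLaw ε δ (a.1 ∩ s)) (fun x => if setCost lo hi a.1 x ≤ b then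
          K * (1 / 2 + ε) - ε * (K - (a.1 ∩ s).card) + V x else 0) := by
  obtain ⟨φ, hφ⟩ : ∃ φ : ℝ → ℝ, ∀ z, φ z = if z ≤ b then 1 else 0 := ⟨_, fun _ => rfl⟩
  have e1 : ∀ x, (if setCost lo hi a.1 x ≤ b then setReward a.1 x + V x else 0)
      = setReward a.1 x * φ (setCost lo hi a.1 x)
        + if setCost lo hi a.1 x ≤ b then V x else 0 := fun x => by
    rw [hφ]; split_ifs <;> ring
  have e2 : ∀ x, (if setCost lo hi a.1 x ≤ b then
        (K * (1 / 2 + ε) - ε * (K - (a.1 ∩ s).card) : ℝ) + V x else 0)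
      = (K / 2 + ε * (a.1 ∩ s).card) * φ (setCost lo hi a.1 x)
        + if setCost lo hi a.1 x ≤ b then V x else 0 := fun x => by
    rw [hφ]; split_ifs <;> ring
  simp only [e1, e2]
  rw [prodExp_add, prodExp_add, prodExp_setReward_mul, prodExp_const_mul, a.2,
    ← Finset.inter_assoc, Finset.inter_self]

theorem plantedValue_fixedPolicy (hlh : lo ≤ hi) (hε0 : 0 ≤ ε) (hε1 : ε ≤ 1 / 2) (hδ0 : 0 ≤ δ)
    (hδ1 : δ ≤ 1 / 2) (s : Arms N K) (n : ℕ) (h : List (Observation N K)) (b : ℝ) :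
    plantedValue (fixedPolicy s) lo hi ε δ s.1 (fun a x => setReward a.1 x) n h b
      = K * (1 / 2 + ε) * paidRounds lo hi (1 / 2 + δ) K n b := by
  induction n generalizing h b with
  | zero => simp [plantedValue, paidRounds]
  | succ n ih =>
    rw [plantedValue, Finset.sum_eq_single s]
    · rw [prodExp_ite_setReward_add]
      simp only [ih, fixedPolicy, PMF.pure_apply, if_true, ENNReal.toReal_one, one_mul,
        Finset.inter_self, s.2, sub_self, mul_zero, sub_zero]
      have e : ∀ x : Fin N → ArmBits, (if setCost lo hi s.1 x ≤ b then
          K * (1 / 2 + ε) + K * (1 / 2 + ε) *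
            paidRounds lo hi (1 / 2 + δ) K n (b - setCost lo hi s.1 x) else 0)
          = K * (1 / 2 + ε) * (fun z => if z ≤ b then
            1 + paidRounds lo hi (1 / 2 + δ) K n (b - z) else 0) (setCost lo hi s.1 x) :=
        fun x => by simp only; split_ifs <;> ring
      simp only [e]
      rw [prodExp_const_mul, prodExp_good_cost hlh hε0 hε1 hδ0 hδ1 s
        (antitone_one_add_paidRounds (by linarith) (by linarith) hlh n b), paidRounds]
    · intro a _ ha
      simp [fixedPolicy, ha]
    · simp

/-- No policy gains more than the good set, less `ε` for every play of an arm that is not good. -/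
theorem plantedValue_reward_le (π : Policy N K) (hlh : lo ≤ hi) (hε0 : 0 ≤ ε) (hε1 : ε ≤ 1 / 2)
    (hδ0 : 0 ≤ δ) (hδ1 : δ ≤ 1 / 2) (s : Finset (Fin N)) (n : ℕ) (h : List (Observation N K))
    (b : ℝ) :
    plantedValue π lo hi ε δ s (fun a x => setReward a.1 x) n h b
      ≤ K * (1 / 2 + ε) * paidRounds lo hi (1 / 2 + δ) K n b
        - ε * plantedValue π lo hi ε δ s (fun a _ => K - (a.1 ∩ s).card) n h b := by
  induction n generalizing h b with
  | zero => simp [plantedValue, paidRounds]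
  | succ n ih =>
    rw [plantedValue, plantedValue]
    have hQ := roundLaw_nonneg (N := N) hε0 hε1 hδ0 hδ1
    have key : ∀ a : Arms N K, prodExp (roundLaw ε δ (a.1 ∩ s)) (fun x =>
          if setCost lo hi a.1 x ≤ b then setReward a.1 x +
            plantedValue π lo hi ε δ s (fun a x => setReward a.1 x) n (observeBits lo hi a x :: h)
            (b - setCost lo hi a.1 x) else 0)
        ≤ K * (1 / 2 + ε) * paidRounds lo hi (1 / 2 + δ) K (n + 1) b
          - ε * prodExp (roundLaw ε δ (a.1 ∩ s)) (fun x =>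
          if setCost lo hi a.1 x ≤ b then (K - (a.1 ∩ s).card : ℝ) +
            plantedValue π lo hi ε δ s (fun a _ => K - (a.1 ∩ s).card) n
              (observeBits lo hi a x :: h) (b - setCost lo hi a.1 x) else 0) := by
      intro a
      rw [prodExp_ite_setReward_add]
      have h1 : prodExp (roundLaw ε δ (a.1 ∩ s)) (fun x => if setCost lo hi a.1 x ≤ b then
          K * (1 / 2 + ε) - ε * (K - (a.1 ∩ s).card) + plantedValue π lo hi ε δ s
            (fun a x => setReward a.1 x) n (observeBits lo hi a x :: h)
            (b - setCost lo hi a.1 x) else 0)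
          ≤ prodExp (roundLaw ε δ (a.1 ∩ s)) (fun x => K * (1 / 2 + ε) *
              (fun z => if z ≤ b then
                1 + paidRounds lo hi (1 / 2 + δ) K n (b - z) else 0) (setCost lo hi a.1 x)
            + (-ε) * if setCost lo hi a.1 x ≤ b then (K - (a.1 ∩ s).card : ℝ) +
              plantedValue π lo hi ε δ s (fun a _ => K - (a.1 ∩ s).card) n
              (observeBits lo hi a x :: h) (b - setCost lo hi a.1 x) else 0) := by
        refine prodExp_mono (hQ _) fun x => ?_
        simp only
        split_ifs
        · have := ih (observeBits lo hi a x :: h) (b - setCost lo hi a.1 x)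
          linarith
        · simp
      rw [prodExp_add, prodExp_const_mul, prodExp_const_mul] at h1
      have h2 := prodExp_cost_le_good hlh hε0 hε1 hδ0 hδ1 (a.1 ∩ s) a
        (antitone_one_add_paidRounds (K := K) (q := 1 / 2 + δ) (by linarith) (by linarith) hlh n b)
      have h3 : 0 ≤ (K : ℝ) * (1 / 2 + ε) := by positivity
      have h4 := mul_le_mul_of_nonneg_left h2 h3
      rw [paidRounds]
      linarith
    calc _ ≤ _ := Finset.sum_le_sum fun a _ =>
          mul_le_mul_of_nonneg_left (key a) ENNReal.toReal_nonneg
      _ = _ := by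
          simp only [mul_sub, Finset.sum_sub_distrib]
          rw [← Finset.sum_mul, sum_policy, one_mul, Finset.mul_sum]
          congr 1
          exact Finset.sum_congr rfl fun a _ => by ring

theorem plantedValue_one_of_empty (π : Policy N K) (hlh : lo ≤ hi) (hε0 : 0 ≤ ε)
    (hε1 : ε ≤ 1 / 2) (hδ0 : 0 ≤ δ) (hδ1 : δ ≤ 1 / 2) (n : ℕ) (h : List (Observation N K))
    (b : ℝ) :
    plantedValue π lo hi ε δ ∅ (fun _ _ => 1) n h b = paidRounds lo hi (1 / 2) K n b := by
  induction n generalizing h b with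
  | zero => rfl
  | succ n ih =>
    rw [plantedValue, paidRounds]
    simp only [ih, Finset.inter_empty]
    have e : ∀ a : Arms N K, prodExp (roundLaw ε δ ∅) (fun x => if setCost lo hi a.1 x ≤ b then
        1 + paidRounds lo hi (1 / 2) K n (b - setCost lo hi a.1 x) else 0) = _ := fun a =>
      prodExp_fair_cost hlh hε0 hε1 hδ0 hδ1 a
        (antitone_one_add_paidRounds (by norm_num) (by norm_num) hlh n b)
    simp only [e]
    rw [← Finset.sum_mul, sum_policy, one_mul]

end Values

/-! ### Pinsker's inequality for adaptive sampling -/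

/-- Expectation of a function of the first `n` steps (the most recent one first), when `p h` are
the weights of the next step after the steps `h`. -/
def pathExp {S : Type*} [Fintype S] (p : List S → S → ℝ) : ℕ → (List S → ℝ) → ℝ
  | 0, F => F []
  | n + 1, F => pathExp p n fun h => ∑ σ, p h σ * F (σ :: h)

section PathExp

variable {S : Type*} [Fintype S] {p : List S → S → ℝ}

theorem pathExp_mono (hp : ∀ h σ, 0 ≤ p h σ) (n : ℕ) {F G : List S → ℝ} (h : ∀ l, F l ≤ G l) :
    pathExp p n F ≤ pathExp p n G := by
  induction n generalizing F G with
  | zero => exact h []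
  | succ n ih =>
    exact ih fun l => Finset.sum_le_sum fun σ _ => mul_le_mul_of_nonneg_left (h _) (hp l σ)

theorem pathExp_add (n : ℕ) (F G : List S → ℝ) :
    pathExp p n (fun l => F l + G l) = pathExp p n F + pathExp p n G := by
  induction n generalizing F G with
  | zero => rfl
  | succ n ih =>
    simp only [pathExp, mul_add, Finset.sum_add_distrib]
    exact ih _ _

theorem pathExp_const_mul (n : ℕ) (k : ℝ) (F : List S → ℝ) :
    pathExp p n (fun l => k * F l) = k * pathExp p n F := by
  induction n generalizing F with
  | zero => rfl
  | succ n ih =>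
    simp only [pathExp, mul_left_comm _ k, ← Finset.mul_sum]
    exact ih _

theorem pathExp_sub (n : ℕ) (F G : List S → ℝ) :
    pathExp p n (fun l => F l - G l) = pathExp p n F - pathExp p n G := by
  have := pathExp_add (p := p) n F fun l => -1 * G l
  rw [pathExp_const_mul] at this
  simpa [sub_eq_add_neg] using this

theorem pathExp_sum {κ : Type*} (t : Finset κ) (n : ℕ) (F : κ → List S → ℝ) :
    pathExp p n (fun l => ∑ k ∈ t, F k l) = ∑ k ∈ t, pathExp p n (F k) := by
  classical
  induction t using Finset.induction_on with
  | empty => simpa using pathExp_const_mul (p := p) n 0 fun _ => 0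
  | insert k t hk ih => simp only [Finset.sum_insert hk, pathExp_add, ih]

theorem pathExp_const (hp : ∀ h, ∑ σ, p h σ = 1) (n : ℕ) (k : ℝ) :
    pathExp p n (fun _ => k) = k := by
  induction n with
  | zero => rfl
  | succ n ih =>
    simp only [pathExp, ← Finset.sum_mul, hp, one_mul]
    exact ih

theorem pathExp_sum_map (hp : ∀ h, ∑ σ, p h σ = 1) {f : S → ℝ} {k : ℝ}
    (hf : ∀ h, ∑ σ, p h σ * f σ = k) (n : ℕ) :
    pathExp p n (fun l => (l.map f).sum) = n * k := by
  induction n with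
  | zero => simp [pathExp]
  | succ n ih =>
    simp only [pathExp, List.map_cons, List.sum_cons, mul_add, Finset.sum_add_distrib, hf,
      ← Finset.sum_mul, hp, one_mul]
    rw [pathExp_add, pathExp_const hp, ih]
    push_cast
    ring

/-- Likelihood ratios. -/
theorem pathExp_mul_weight (ℓ : S → ℝ) (n : ℕ) (F : List S → ℝ) :
    pathExp (fun h σ => p h σ * ℓ σ) n F = pathExp p n (fun l => (l.map ℓ).prod * F l) := by
  induction n generalizing F with
  | zero => simp [pathExp]
  | succ n ih =>
    simp only [pathExp]
    rw [ih]
    congr 1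
    funext l
    rw [Finset.mul_sum]
    refine Finset.sum_congr rfl fun σ _ => ?_
    simp only [List.map_cons, List.prod_cons]
    ring

end PathExp

/-- The pointwise inequality behind Pinsker's inequality. -/
theorem three_mul_sq_le_log {ρ : ℝ} (hρ : 0 < ρ) :
    3 * (1 - ρ) ^ 2 ≤ (2 + 4 * ρ) * (ρ - 1 - Real.log ρ) := by
  let f : ℝ → ℝ := fun x => x - 1 - Real.log x - 3 * (1 - x) ^ 2 / (2 + 4 * x)
  have hd : ∀ x, 0 < x → HasDerivAt f (4 * (x - 1) ^ 3 / (x * (2 + 4 * x) ^ 2)) x := by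
    intro x hx
    have h1 : (2 + 4 * x) ≠ 0 := by positivity
    have hnum : HasDerivAt (fun x : ℝ => 3 * (1 - x) ^ 2) (3 * (2 * (1 - x) * (-1))) x := by
      have := (((hasDerivAt_id x).const_sub 1).pow 2).const_mul 3
      simpa using this
    have hden : HasDerivAt (fun x : ℝ => 2 + 4 * x) 4 x := by
      simpa using ((hasDerivAt_id x).const_mul 4).const_add 2
    have := (((hasDerivAt_id x).sub_const 1).sub (Real.hasDerivAt_log hx.ne')).sub
      (hnum.div hden h1)
    refine this.congr_deriv ?_
    field_simp
    ring
  have hc : ∀ x, 0 < x → ContinuousAt f x := fun x hx => (hd x hx).continuousAt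
  have hf1 : f 1 = 0 := by simp [f]
  have hf : 0 ≤ f ρ := by
    rcases le_total ρ 1 with h | h
    · have : AntitoneOn f (Set.Ioc 0 1) := by
        refine antitoneOn_of_deriv_nonpos (convex_Ioc 0 1)
          (fun x hx => (hc x hx.1).continuousWithinAt) ?_ ?_
        · rw [interior_Ioc]
          exact fun x hx => (hd x hx.1).differentiableAt.differentiableWithinAt
        · rw [interior_Ioc]
          intro x hx
          rw [(hd x hx.1).deriv]
          have h3 : (x - 1) ^ 3 ≤ 0 := by
            have : (x - 1) ^ 3 = (x - 1) * (x - 1) ^ 2 := by ring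
            rw [this]
            exact mul_nonpos_of_nonpos_of_nonneg (by linarith [hx.2]) (sq_nonneg _)
          have := hx.1
          exact div_nonpos_of_nonpos_of_nonneg (by linarith) (by positivity)
      have := this ⟨hρ, h⟩ ⟨zero_lt_one, le_rfl⟩ h
      linarith
    · have : MonotoneOn f (Set.Ici 1) := by
        refine monotoneOn_of_deriv_nonneg (convex_Ici 1)
          (fun x hx => (hc x (zero_lt_one.trans_le hx)).continuousWithinAt) ?_ ?_
        · rw [interior_Ici]
          exact fun x hx =>
            (hd x (zero_lt_one.trans hx)).differentiableAt.differentiableWithinAt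
        · rw [interior_Ici]
          intro x hx
          have hx : 1 < x := hx
          rw [(hd x (by linarith)).deriv]
          have : 0 ≤ x - 1 := by linarith
          have : 0 ≤ x := by linarith
          positivity
      have := this (Set.self_mem_Ici) h h
      linarith
  have h2 : 0 < 2 + 4 * ρ := by positivity
  have : 3 * (1 - ρ) ^ 2 / (2 + 4 * ρ) ≤ ρ - 1 - Real.log ρ := by
    simp only [f] at hf
    linarith
  rw [div_le_iff₀ h2] at this
  linarith

theorem abs_one_sub_le_log {ρ k : ℝ} (hρ : 0 < ρ) (hk : 0 < k) :
    |1 - ρ| ≤ ((2 + 4 * ρ) / 3 / k + k * (ρ - 1 - Real.log ρ)) / 2 := by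
  have h1 := three_mul_sq_le_log hρ
  have h2 : 0 ≤ ρ - 1 - Real.log ρ := by linarith [Real.log_le_sub_one_of_pos hρ]
  have hD0 : 0 ≤ k * (ρ - 1 - Real.log ρ) := mul_nonneg hk.le h2
  have hA0 : 0 ≤ (2 + 4 * ρ) / 3 / k := by positivity
  have hAD : (2 + 4 * ρ) / 3 / k * (k * (ρ - 1 - Real.log ρ))
      = (2 + 4 * ρ) * (ρ - 1 - Real.log ρ) / 3 := by
    field_simp
  refine abs_le_of_sq_le_sq ?_ (by positivity)
  nlinarith [sq_nonneg ((2 + 4 * ρ) / 3 / k - k * (ρ - 1 - Real.log ρ))]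

/-- Pinsker's inequality for two adaptive processes whose steps have the likelihood ratio `ℓ`,
with the square root replaced by a free parameter `k`. -/
theorem pathExp_sub_le {S : Type*} [Fintype S] {p : List S → S → ℝ} {ℓ : S → ℝ}
    (hp0 : ∀ h σ, 0 ≤ p h σ) (hp : ∀ h, ∑ σ, p h σ = 1) (hℓ : ∀ σ, 0 < ℓ σ)
    (hpℓ : ∀ h, ∑ σ, p h σ * ℓ σ = 1) {C : ℝ} {F : List S → ℝ}
    (hF0 : ∀ l, 0 ≤ F l) (hFC : ∀ l, F l ≤ C) (n : ℕ) {k : ℝ} (hk : 0 < k) :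
    pathExp p n F - pathExp (fun h σ => p h σ * ℓ σ) n F
      ≤ C / 4 * (2 / k + k * pathExp p n (fun l => (l.map fun σ => -Real.log (ℓ σ)).sum)) := by
  have hC : 0 ≤ C := (hF0 []).trans (hFC [])
  have hρ : ∀ l : List S, 0 < (l.map ℓ).prod := fun l => List.prod_pos (by simpa using fun σ _ => hℓ σ)
  have hlog : ∀ l : List S, Real.log (l.map ℓ).prod = -(l.map fun σ => -Real.log (ℓ σ)).sum := by
    intro l
    induction l with
    | nil => simp
    | cons σ l ih =>
      simp only [List.map_cons, List.prod_cons, List.sum_cons]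
      rw [Real.log_mul (hℓ σ).ne' (hρ l).ne', ih]
      ring
  have hρ1 : pathExp p n (fun l => (l.map ℓ).prod) = 1 := by
    have := pathExp_mul_weight (p := p) ℓ n fun _ => 1
    rw [pathExp_const hpℓ] at this
    simpa using this.symm
  have hpt : ∀ l, F l - (l.map ℓ).prod * F l ≤ C / 4 * (2 / 3 / k - k)
      + C / 2 + (C / 4 * (4 / 3 / k + k) - C / 2) * (l.map ℓ).prod
      + C / 4 * k * (l.map fun σ => -Real.log (ℓ σ)).sum := by
    intro l
    have h1 := abs_one_sub_le_log (hρ l) hk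
    have h2 : (1 - (l.map ℓ).prod) * (F l - C / 2) ≤ C / 2 * |1 - (l.map ℓ).prod| := by
      refine (le_abs_self _).trans ?_
      rw [abs_mul, mul_comm]
      refine mul_le_mul_of_nonneg_right ?_ (abs_nonneg _)
      rw [abs_le]
      constructor <;> linarith [hF0 l, hFC l]
    have h3 := mul_le_mul_of_nonneg_left h1 (by positivity : 0 ≤ C / 2)
    rw [hlog] at h3
    set P := (l.map ℓ).prod
    have e : C / 2 * (((2 + 4 * P) / 3 / k + k * (P - 1 - -(l.map fun σ => -Real.log (ℓ σ)).sum)) / 2)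
        = C / 4 * (2 / 3 / k - k) + C / 4 * (4 / 3 / k + k) * P
          + C / 4 * k * (l.map fun σ => -Real.log (ℓ σ)).sum := by
      field_simp
      ring
    rw [e] at h3
    linarith
  have h := pathExp_mono hp0 n hpt
  rw [pathExp_sub, ← pathExp_mul_weight, pathExp_add, pathExp_add, pathExp_const hp,
    pathExp_const_mul, pathExp_const_mul, hρ1] at h
  refine h.trans (le_of_eq ?_)
  field_simp
  ring

/-! ### The regret in the planted environment -/

/-- A round: the set that is played and all bits of that round. -/
abbrev Round (N K : ℕ) : Type := Arms N K × (Fin N → ArmBits)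

section Rounds

variable {N K : ℕ}

/-- The weights of the next round, when the arms in `s` are good. -/
def roundWeight (π : Policy N K) (lo hi ε δ : ℝ) (s : Finset (Fin N)) (h : List (Round N K))
    (σ : Round N K) : ℝ :=
  (π (h.map fun τ => observeBits lo hi τ.1 τ.2) σ.1).toReal
    * ∏ i, roundLaw ε δ (σ.1.1 ∩ s) i (σ.2 i)

/-- The budget that remains after the rounds `h`. -/
def remaining (lo hi B : ℝ) (h : List (Round N K)) : ℝ :=
  B - (h.map fun τ => setCost lo hi τ.1.1 τ.2).sum

variable {π : Policy N K} {lo hi ε δ : ℝ}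

theorem sum_roundWeight_mul (s : Finset (Fin N)) (h : List (Round N K)) (F : Round N K → ℝ) :
    ∑ σ, roundWeight π lo hi ε δ s h σ * F σ
      = ∑ a, (π (h.map fun τ => observeBits lo hi τ.1 τ.2) a).toReal
          * prodExp (roundLaw ε δ (a.1 ∩ s)) (fun x => F (a, x)) := by
  rw [Fintype.sum_prod_type]
  refine Finset.sum_congr rfl fun a _ => ?_
  rw [prodExp, Finset.mul_sum]
  exact Finset.sum_congr rfl fun x _ => by rw [roundWeight, mul_assoc]

theorem sum_roundWeight (s : Finset (Fin N)) (h : List (Round N K)) :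
    ∑ σ, roundWeight π lo hi ε δ s h σ = 1 := by
  have := sum_roundWeight_mul (π := π) (lo := lo) (hi := hi) (ε := ε) (δ := δ) s h fun _ => 1
  simp only [mul_one, prodExp_const (sum_roundLaw _), sum_policy] at this
  exact this

theorem roundWeight_nonneg (hε0 : 0 ≤ ε) (hε1 : ε ≤ 1 / 2) (hδ0 : 0 ≤ δ) (hδ1 : δ ≤ 1 / 2)
    (s : Finset (Fin N)) (h : List (Round N K)) (σ : Round N K) :
    0 ≤ roundWeight π lo hi ε δ s h σ :=
  mul_nonneg ENNReal.toReal_nonneg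
    (Finset.prod_nonneg fun i _ => roundLaw_nonneg hε0 hε1 hδ0 hδ1 _ i _)

theorem setCost_nonneg (hlo : 0 ≤ lo) (hlh : lo ≤ hi) (a : Finset (Fin N))
    (x : Fin N → ArmBits) : 0 ≤ setCost lo hi a x := by
  refine Finset.sum_nonneg fun i _ => ?_
  unfold ArmBits.cost
  split_ifs <;> linarith

/-- The expected payoff as a sum over the rounds. -/
theorem pathExp_plantedValue (hlo : 0 ≤ lo) (hlh : lo ≤ hi) (s : Finset (Fin N))
    (r : Arms N K → ℝ) (B : ℝ) (n t : ℕ) :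
    pathExp (roundWeight π lo hi ε δ s) t (fun h => if 0 ≤ remaining lo hi B h then
        plantedValue π lo hi ε δ s (fun a _ => r a) n
          (h.map fun τ => observeBits lo hi τ.1 τ.2) (remaining lo hi B h) else 0)
      = ∑ j ∈ Finset.range n, pathExp (roundWeight π lo hi ε δ s) (t + j) (fun h =>
          ∑ a, (π (h.map fun τ => observeBits lo hi τ.1 τ.2) a).toReal * (r a *
            prodExp (roundLaw ε δ (a.1 ∩ s))
              (fun x => if setCost lo hi a.1 x ≤ remaining lo hi B h then 1 else 0))) := by
  induction n generalizing t with
  | zero =>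
    simp only [plantedValue, ite_self, Finset.range_zero, Finset.sum_empty]
    simpa using pathExp_const_mul (p := roundWeight π lo hi ε δ s) t 0 fun _ => 0
  | succ n ih =>
    rw [Finset.sum_range_succ', add_zero]
    have e : ∀ j, t + 1 + j = t + (j + 1) := fun j => by ring
    have ih' := ih (t + 1)
    simp only [e] at ih'
    rw [← ih', pathExp, ← pathExp_add]
    congr 1
    funext h
    rw [sum_roundWeight_mul, ← Finset.sum_add_distrib]
    have hrem : ∀ (a : Arms N K) (x : Fin N → ArmBits), remaining lo hi B ((a, x) :: h)
        = remaining lo hi B h - setCost lo hi a.1 x := fun a x => by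
      simp only [remaining, List.map_cons, List.sum_cons]
      ring
    simp only [hrem, List.map_cons, sub_nonneg]
    by_cases hb : 0 ≤ remaining lo hi B h
    · rw [if_pos hb, plantedValue]
      refine Finset.sum_congr rfl fun a _ => ?_
      rw [← mul_add]
      congr 1
      rw [← prodExp_const_mul _ (r a), ← prodExp_add]
      congr 1
      funext x
      split_ifs <;> ring
    · rw [if_neg hb]
      symm
      refine Finset.sum_eq_zero fun a _ => ?_
      have : ∀ x, ¬ setCost lo hi a.1 x ≤ remaining lo hi B h := fun x hx =>
        hb ((setCost_nonneg hlo hlh _ _).trans hx)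
      simp only [this, if_false, mul_zero, add_zero, prodExp_const (sum_roundLaw _)]

theorem plantedValue_eq_sum (hlo : 0 ≤ lo) (hlh : lo ≤ hi) (s : Finset (Fin N))
    (r : Arms N K → ℝ) {B : ℝ} (hB : 0 ≤ B) (n : ℕ) :
    plantedValue π lo hi ε δ s (fun a _ => r a) n [] B
      = ∑ t ∈ Finset.range n, pathExp (roundWeight π lo hi ε δ s) t (fun h =>
          ∑ a, (π (h.map fun τ => observeBits lo hi τ.1 τ.2) a).toReal * (r a *
            prodExp (roundLaw ε δ (a.1 ∩ s))
              (fun x => if setCost lo hi a.1 x ≤ remaining lo hi B h then 1 else 0))) := by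
  have h := pathExp_plantedValue (π := π) (ε := ε) (δ := δ) hlo hlh s r B n 0
  simp only [zero_add] at h
  rw [← h]
  simp [pathExp, remaining, hB]

/-- Likelihood ratio of a round between good set `s` and no good arms. -/
def roundRatio (ε δ : ℝ) (s : Finset (Fin N)) (σ : Round N K) : ℝ :=
  ∏ i ∈ σ.1.1 ∩ s, 4 * armLaw (1 / 2 + ε) (1 / 2 + δ) (σ.2 i)

theorem roundWeight_eq (s : Finset (Fin N)) (h : List (Round N K)) (σ : Round N K) :
    roundWeight π lo hi ε δ s h σ
      = roundWeight π lo hi ε δ ∅ h σ * roundRatio ε δ s σ := by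
  rw [roundWeight, roundWeight, roundRatio, mul_assoc]
  congr 1
  have hite : ∏ i ∈ σ.1.1 ∩ s, 4 * armLaw (1 / 2 + ε) (1 / 2 + δ) (σ.2 i)
      = ∏ i, if i ∈ σ.1.1 ∩ s then 4 * armLaw (1 / 2 + ε) (1 / 2 + δ) (σ.2 i) else 1 := by
    rw [Finset.prod_ite_mem, Finset.univ_inter]
  rw [hite, ← Finset.prod_mul_distrib]
  refine Finset.prod_congr rfl fun i _ => ?_
  have h4 : armLaw (1 / 2) (1 / 2) (σ.2 i) = 1 / 4 := by
    simp only [armLaw, coin]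
    split_ifs <;> norm_num
  by_cases hi' : i ∈ σ.1.1 ∩ s
  · simp only [roundLaw, if_pos hi', Finset.inter_empty, Finset.notMem_empty, if_false, h4]
    ring
  · simp only [roundLaw, if_neg hi', Finset.inter_empty, Finset.notMem_empty, if_false, mul_one]

theorem four_mul_armLaw_pos (hε0 : 0 ≤ ε) (hε1 : ε < 1 / 2) (hδ0 : 0 ≤ δ) (hδ1 : δ < 1 / 2)
    (y : ArmBits) : 0 < 4 * armLaw (1 / 2 + ε) (1 / 2 + δ) y := by
  have h : ∀ b, ∀ e : ℝ, 0 ≤ e → e < 1 / 2 → 0 < coin (1 / 2 + e) b := fun b e h0 h1 => by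
    unfold coin
    split_ifs <;> linarith
  exact mul_pos (by norm_num) (mul_pos (h _ _ hε0 hε1) (h _ _ hδ0 hδ1))

/-- Twice the relative entropy of the bits of a fair arm with respect to those of a good arm. -/
def bitsEntropy (ε δ : ℝ) : ℝ := -Real.log (1 - 4 * ε ^ 2) - Real.log (1 - 4 * δ ^ 2)

theorem bitsEntropy_nonneg (hε0 : 0 ≤ ε) (hε1 : ε < 1 / 2) (hδ0 : 0 ≤ δ) (hδ1 : δ < 1 / 2) :
    0 ≤ bitsEntropy ε δ := by
  have h1 : Real.log (1 - 4 * ε ^ 2) ≤ 0 := Real.log_nonpos (by nlinarith) (by nlinarith)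
  have h2 : Real.log (1 - 4 * δ ^ 2) ≤ 0 := Real.log_nonpos (by nlinarith) (by nlinarith)
  unfold bitsEntropy
  linarith

theorem sum_fair_mul_log (hε0 : 0 ≤ ε) (hε1 : ε < 1 / 2) (hδ0 : 0 ≤ δ) (hδ1 : δ < 1 / 2) :
    ∑ y, armLaw (1 / 2) (1 / 2) y * -Real.log (4 * armLaw (1 / 2 + ε) (1 / 2 + δ) y)
      = bitsEntropy ε δ / 2 := by
  have e : ∀ u v : ℝ, 0 < u → 0 < v →
      Real.log (4 * (u * v)) = Real.log (2 * u) + Real.log (2 * v) := fun u v hu hv => by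
    rw [← Real.log_mul (by positivity) (by positivity)]
    congr 1
    ring
  have f : ∀ x : ℝ, 0 ≤ x → x < 1 / 2 → Real.log (1 - 4 * x ^ 2)
      = Real.log (2 * (1 / 2 + x)) + Real.log (2 * (1 - (1 / 2 + x))) := fun x h0 h1 => by
    rw [← Real.log_mul (by linarith) (by linarith)]
    congr 1
    ring
  rw [bitsEntropy, f ε hε0 hε1, f δ hδ0 hδ1]
  simp only [Fintype.sum_prod_type, Fintype.sum_bool, armLaw, coin, if_true, Bool.false_eq_true,
    if_false]
  rw [e _ _ (by linarith) (by linarith), e _ _ (by linarith) (by linarith),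
    e _ _ (by linarith) (by linarith), e _ _ (by linarith) (by linarith)]
  ring

theorem prodExp_log_roundRatio (hε0 : 0 ≤ ε) (hε1 : ε < 1 / 2) (hδ0 : 0 ≤ δ) (hδ1 : δ < 1 / 2)
    (s : Finset (Fin N)) (a : Arms N K) :
    prodExp (roundLaw ε δ ∅) (fun x => -Real.log (roundRatio ε δ s (a, x)))
      = (a.1 ∩ s).card * (bitsEntropy ε δ / 2) := by
  have h : ∀ x : Fin N → ArmBits, -Real.log (roundRatio ε δ s (a, x))
      = ∑ i ∈ a.1 ∩ s, -Real.log (4 * armLaw (1 / 2 + ε) (1 / 2 + δ) (x i)) := fun x => by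
    rw [roundRatio, Real.log_prod fun i _ => (four_mul_armLaw_pos hε0 hε1 hδ0 hδ1 _).ne',
      Finset.sum_neg_distrib]
  simp only [h]
  rw [prodExp_sum, ← nsmul_eq_mul, ← Finset.sum_const]
  refine Finset.sum_congr rfl fun i _ => ?_
  rw [prodExp_update_self i (sum_roundLaw ∅ i), ← sum_fair_mul_log hε0 hε1 hδ0 hδ1]
  refine Finset.sum_congr rfl fun y _ => ?_
  simp only [Function.update_self]
  rw [prodExp_const (sum_roundLaw ∅)]
  simp [roundLaw]

end Rounds

/-! ### Averages over the good set -/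

section Averages

variable {N K : ℕ}

theorem card_arms_pos (hKN : K ≤ N) : 0 < (Fintype.card (Arms N K) : ℝ) := by
  obtain ⟨t, -, ht⟩ := Finset.exists_subset_card_eq (s := (Finset.univ : Finset (Fin N)))
    (n := K) (by simpa using hKN)
  have : Nonempty (Arms N K) := ⟨⟨t, ht⟩⟩
  exact_mod_cast Fintype.card_pos

/-- All arms lie in the same number of sets of `K` arms. -/
theorem card_arms_mem (i : Fin N) :
    (N : ℝ) * ∑ s : Arms N K, (if i ∈ s.1 then 1 else 0) = K * Fintype.card (Arms N K) := by
  have hsymm : ∀ j, ∑ s : Arms N K, (if j ∈ s.1 then (1 : ℝ) else 0)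
      = ∑ s : Arms N K, if i ∈ s.1 then 1 else 0 := by
    intro j
    let f : Arms N K → Arms N K := fun s =>
      ⟨s.1.map (Equiv.swap i j).toEmbedding, by rw [Finset.card_map, s.2]⟩
    have hf : Function.Involutive f := fun s => by
      apply Subtype.ext
      simp only [f, Finset.map_map]
      ext k
      simp
    refine Fintype.sum_equiv hf.toPerm _ _ fun s => ?_
    have : j ∈ s.1 ↔ i ∈ (f s).1 := by
      simp only [f, Finset.mem_map_equiv, Equiv.symm_swap, Equiv.swap_apply_left]
    exact if_congr this rfl rfl
  calc (N : ℝ) * ∑ s : Arms N K, (if i ∈ s.1 then (1 : ℝ) else 0)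
      = ∑ j : Fin N, ∑ s : Arms N K, (if j ∈ s.1 then (1 : ℝ) else 0) := by
        simp [hsymm]
    _ = ∑ s : Arms N K, ∑ j : Fin N, (if j ∈ s.1 then (1 : ℝ) else 0) := Finset.sum_comm
    _ = ∑ s : Arms N K, (K : ℝ) := by
        refine Finset.sum_congr rfl fun s _ => ?_
        simp [s.2]
    _ = _ := by simp [mul_comm]

theorem sum_card_inter (hK : 1 ≤ K) (hKN : K ≤ N) (a : Arms N K) :
    ∑ s : Arms N K, ((a.1 ∩ s.1).card : ℝ) = Fintype.card (Arms N K) * (K * K / N) := by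
  have hN : (N : ℝ) ≠ 0 := by exact_mod_cast (by omega : N ≠ 0)
  have h1 : ∀ s : Arms N K, ((a.1 ∩ s.1).card : ℝ) = ∑ i ∈ a.1, if i ∈ s.1 then 1 else 0 := by
    intro s
    rw [Finset.sum_boole, Finset.filter_mem_eq_inter]
  simp only [h1]
  rw [Finset.sum_comm]
  have h2 : ∀ i ∈ a.1, ∑ s : Arms N K, (if i ∈ s.1 then (1 : ℝ) else 0)
      = K * Fintype.card (Arms N K) / N := fun i _ => by
    rw [eq_div_iff hN, mul_comm, card_arms_mem]
  rw [Finset.sum_congr rfl h2, Finset.sum_const, a.2, nsmul_eq_mul]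
  ring

end Averages

/-- The infimum over `k` of the bound in Pinsker's inequality. -/
theorem le_sqrt_of_forall_le {v u w : ℝ} (hu : 0 ≤ u) (hw : 0 ≤ w)
    (h : ∀ k > 0, v ≤ u / k + k * w) : v ≤ 2 * √(u * w) := by
  rcases hw.eq_or_lt with rfl | hw
  · simp only [mul_zero, add_zero, Real.sqrt_zero] at h ⊢
    refine le_of_forall_pos_le_add fun e he => ?_
    have h1 := h ((u + 1) / e) (by positivity)
    have h2 : u / ((u + 1) / e) ≤ e := by
      rw [div_div_eq_mul_div, div_le_iff₀ (by positivity)]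
      nlinarith
    linarith
  · rcases hu.eq_or_lt with rfl | hu
    · simp only [zero_div, zero_mul, zero_add, Real.sqrt_zero, mul_zero] at h ⊢
      refine le_of_forall_pos_le_add fun e he => ?_
      have h1 := h (e / w) (by positivity)
      rwa [div_mul_cancel₀ _ hw.ne', ← zero_add e] at h1
    · have h1 := h (√u / √w) (by positivity)
      rw [Real.sqrt_mul hu.le]
      have e1 : u / (√u / √w) = √u * √w := by
        have := Real.mul_self_sqrt hu.le
        have : √u ≠ 0 := by positivity
        field_simp
        nlinarith [Real.mul_self_sqrt hu.le]
      have e2 : √u / √w * w = √u * √w := by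
        have : √w ≠ 0 := by positivity
        field_simp
        nlinarith [Real.mul_self_sqrt hw.le]
      rw [e1, e2] at h1
      linarith

section Regret

variable {N K : ℕ} {lo hi ε δ : ℝ}

/-- Averaged over the good set, every policy often plays arms that are not good. -/
theorem le_sum_plantedValue_missed (π : Policy N K) (hK : 1 ≤ K) (hKN : K ≤ N) (hlo : 0 ≤ lo)
    (hlh : lo ≤ hi) (hε0 : 0 ≤ ε) (hε1 : ε < 1 / 2) (hδ0 : 0 ≤ δ) (hδ1 : δ < 1 / 2) {B : ℝ}
    (hB : 0 ≤ B) (M : ℕ) :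
    Fintype.card (Arms N K) * (K * (1 - K / N) * paidRounds lo hi (1 / 2) K M B
        - K ^ 2 / 2 * √(bitsEntropy ε δ * (M ^ 2 * (M - 1)) / (2 * N)))
      ≤ ∑ s : Arms N K,
        plantedValue π lo hi ε δ s.1 (fun a _ => K - (a.1 ∩ s.1).card) M [] B := by
  have hN : (0 : ℝ) < N := by exact_mod_cast (by omega : 0 < N)
  have hc := card_arms_pos (N := N) hKN
  have hκ := bitsEntropy_nonneg hε0 hε1 hδ0 hδ1
  set card := (Fintype.card (Arms N K) : ℝ) with hcard
  let p0 : List (Round N K) → Round N K → ℝ := roundWeight π lo hi ε δ ∅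
  let obs : List (Round N K) → List (Observation N K) := fun h =>
    h.map fun τ => observeBits lo hi τ.1 τ.2
  let g : Arms N K → List (Round N K) → ℝ := fun s h =>
    ∑ a, (π (obs h) a).toReal * ((K - (a.1 ∩ s.1).card) *
      affordProb lo hi K (remaining lo hi B h))
  have hp0 : ∀ s h σ, 0 ≤ roundWeight π lo hi ε δ s h σ :=
    roundWeight_nonneg hε0 hε1.le hδ0 hδ1.le
  have hmiss : ∀ a s : Arms N K, 0 ≤ (K : ℝ) - (a.1 ∩ s.1).card := fun a s => by
    have : (a.1 ∩ s.1).card ≤ K := (Finset.card_le_card Finset.inter_subset_left).trans_eq a.2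
    have : ((a.1 ∩ s.1).card : ℝ) ≤ K := by exact_mod_cast this
    linarith
  have hg0 : ∀ s h, 0 ≤ g s h := fun s h => Finset.sum_nonneg fun a _ =>
    mul_nonneg ENNReal.toReal_nonneg (mul_nonneg (hmiss a s) (affordProb_nonneg hlh _))
  have hgK : ∀ s h, g s h ≤ K := fun s h => by
    calc g s h ≤ ∑ a, (π (obs h) a).toReal * K := by
          refine Finset.sum_le_sum fun a _ => mul_le_mul_of_nonneg_left ?_ ENNReal.toReal_nonneg
          have h1 := affordProb_le_one (lo := lo) (hi := hi) (K := K) (remaining lo hi B h)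
          have h2 := mul_le_mul_of_nonneg_left h1 (hmiss a s)
          have h3 : (0 : ℝ) ≤ (a.1 ∩ s.1).card := Nat.cast_nonneg _
          linarith
      _ = K := by rw [← Finset.sum_mul, sum_policy, one_mul]
  have hlow : ∀ s : Arms N K, ∑ t ∈ Finset.range M,
      pathExp (roundWeight π lo hi ε δ s.1) t (g s)
      ≤ plantedValue π lo hi ε δ s.1 (fun a _ => K - (a.1 ∩ s.1).card) M [] B := by
    intro s
    rw [plantedValue_eq_sum hlo hlh s.1 (fun a : Arms N K => (K : ℝ) - (a.1 ∩ s.1).card) hB]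
    refine Finset.sum_le_sum fun t _ => pathExp_mono (hp0 s.1) t fun h => ?_
    refine Finset.sum_le_sum fun a _ => mul_le_mul_of_nonneg_left ?_ ENNReal.toReal_nonneg
    exact mul_le_mul_of_nonneg_left
      (affordProb_le_prodExp hlh hε0 hε1.le hδ0 hδ1.le _ a _) (hmiss a s)
  have hpin : ∀ (s : Arms N K) (t : ℕ) (k : ℝ), 0 < k →
      pathExp p0 t (g s) - pathExp (roundWeight π lo hi ε δ s.1) t (g s)
      ≤ K / 4 * (2 / k + k * pathExp p0 t
          (fun l => (l.map fun σ => -Real.log (roundRatio ε δ s.1 σ)).sum)) := by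
    intro s t k hk
    have he : roundWeight π lo hi ε δ s.1 = fun h σ => p0 h σ * roundRatio ε δ s.1 σ :=
      funext fun h => funext fun σ => roundWeight_eq s.1 h σ
    rw [he]
    refine pathExp_sub_le (hp0 ∅) (sum_roundWeight ∅)
      (fun σ => Finset.prod_pos fun i _ => four_mul_armLaw_pos hε0 hε1 hδ0 hδ1 _)
      (fun h => ?_) (hg0 s) (hgK s) t hk
    have := sum_roundWeight (π := π) (lo := lo) (hi := hi) (ε := ε) (δ := δ) s.1 h
    rwa [he] at this
  have hsumg : ∀ h, ∑ s, g s h = card * (K * (1 - K / N))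
      * affordProb lo hi K (remaining lo hi B h) := by
    intro h
    simp only [g]
    rw [Finset.sum_comm]
    simp only [← Finset.mul_sum, ← Finset.sum_mul]
    have e : ∀ a : Arms N K, ∑ s : Arms N K, ((K : ℝ) - (a.1 ∩ s.1).card)
        = card * (K * (1 - K / N)) := fun a => by
      rw [Finset.sum_sub_distrib, sum_card_inter hK hKN, Finset.sum_const, nsmul_eq_mul,
        Finset.card_univ]
      ring
    simp only [e]
    rw [← Finset.sum_mul, sum_policy, one_mul]
  have hτ : ∑ t ∈ Finset.range M, pathExp p0 t
      (fun h => affordProb lo hi K (remaining lo hi B h)) = paidRounds lo hi (1 / 2) K M B := by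
    rw [← plantedValue_one_of_empty π hlh hε0 hε1.le hδ0 hδ1.le M [] B,
      plantedValue_eq_sum hlo hlh ∅ (fun _ => 1) hB]
    refine Finset.sum_congr rfl fun t _ => ?_
    congr 1
    funext h
    have e : ∀ a : Arms N K, prodExp (roundLaw ε δ (a.1 ∩ ∅))
        (fun x => if setCost lo hi a.1 x ≤ remaining lo hi B h then (1 : ℝ) else 0)
        = affordProb lo hi K (remaining lo hi B h) := fun a => by
      rw [Finset.inter_empty]
      exact prodExp_fair_cost hlh hε0 hε1.le hδ0 hδ1.le a (antitone_indicator_le _)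
    simp only [e, one_mul]
    rw [← Finset.sum_mul, sum_policy, one_mul]
  have hent : ∀ t, ∑ s : Arms N K, pathExp p0 t
      (fun l => (l.map fun σ => -Real.log (roundRatio ε δ s.1 σ)).sum)
      = t * (card * (K * K / N) * (bitsEntropy ε δ / 2)) := by
    intro t
    rw [← pathExp_sum]
    have e : ∀ l : List (Round N K), ∑ s : Arms N K,
        (l.map fun σ => -Real.log (roundRatio ε δ s.1 σ)).sum
        = (l.map fun σ => ∑ s : Arms N K, -Real.log (roundRatio ε δ s.1 σ)).sum := by
      intro l
      induction l with
      | nil => simp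
      | cons σ l ih =>
        simp only [List.map_cons, List.sum_cons, Finset.sum_add_distrib, ih]
    simp only [e]
    refine pathExp_sum_map (sum_roundWeight ∅) (fun h => ?_) t
    rw [sum_roundWeight_mul]
    have e2 : ∀ a : Arms N K, prodExp (roundLaw ε δ (a.1 ∩ ∅))
        (fun x => ∑ s : Arms N K, -Real.log (roundRatio ε δ s.1 (a, x)))
        = card * (K * K / N) * (bitsEntropy ε δ / 2) := fun a => by
      rw [Finset.inter_empty, prodExp_sum]
      simp only [prodExp_log_roundRatio hε0 hε1 hδ0 hδ1]
      rw [← Finset.sum_mul, sum_card_inter hK hKN]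
    simp only [e2]
    rw [← Finset.sum_mul, sum_policy, one_mul]
  have hrange : ∑ t ∈ Finset.range M, (t : ℝ) = M * (M - 1) / 2 := by
    clear * -
    induction M with
    | zero => simp
    | succ M ih =>
      rw [Finset.sum_range_succ, ih]
      push_cast
      ring
  have hM : (0 : ℝ) ≤ M * (M - 1) := by
    rcases Nat.eq_zero_or_pos M with h | h
    · simp [h]
    · have : (1 : ℝ) ≤ M := by exact_mod_cast h
      exact mul_nonneg (by linarith) (by linarith)
  set L := ∑ s : Arms N K,
    plantedValue π lo hi ε δ s.1 (fun a _ => K - (a.1 ∩ s.1).card) M [] B with hL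
  have hfinal : ∀ k > 0, K * (1 - K / N) * paidRounds lo hi (1 / 2) K M B - L / card
      ≤ (K * M / 2) / k
        + k * (K / 4 * (M * (M - 1) / 2 * ((K * K / N) * (bitsEntropy ε δ / 2)))) := by
    intro k hk
    have h1 : card * (K * (1 - K / N)) * paidRounds lo hi (1 / 2) K M B - L
        ≤ ∑ s : Arms N K, ∑ t ∈ Finset.range M, K / 4 * (2 / k + k * pathExp p0 t
          (fun l => (l.map fun σ => -Real.log (roundRatio ε δ s.1 σ)).sum)) := by
      have h2 : ∑ s : Arms N K, ∑ t ∈ Finset.range M, pathExp p0 t (g s)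
          = card * (K * (1 - K / N)) * paidRounds lo hi (1 / 2) K M B := by
        rw [Finset.sum_comm, ← hτ, Finset.mul_sum]
        refine Finset.sum_congr rfl fun t _ => ?_
        rw [← pathExp_sum, ← pathExp_const_mul]
        simp only [hsumg]
      rw [← h2, hL, ← Finset.sum_sub_distrib]
      refine Finset.sum_le_sum fun s _ => ?_
      refine (sub_le_sub_left (hlow s) _).trans ?_
      rw [← Finset.sum_sub_distrib]
      exact Finset.sum_le_sum fun t _ => hpin s t k hk
    have h3 : ∑ s : Arms N K, ∑ t ∈ Finset.range M, K / 4 * (2 / k + k * pathExp p0 t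
          (fun l => (l.map fun σ => -Real.log (roundRatio ε δ s.1 σ)).sum))
        = card * ((K * M / 2) / k
        + k * (K / 4 * (M * (M - 1) / 2 * ((K * K / N) * (bitsEntropy ε δ / 2))))) := by
      rw [Finset.sum_comm]
      have h4 : ∀ t ∈ Finset.range M, ∑ s : Arms N K, K / 4 * (2 / k + k * pathExp p0 t
          (fun l => (l.map fun σ => -Real.log (roundRatio ε δ s.1 σ)).sum))
          = card * (K / 2 / k)
            + t * (card * (k * (K / 4 * ((K * K / N) * (bitsEntropy ε δ / 2))))) := by
        intro t _
        rw [← Finset.mul_sum, Finset.sum_add_distrib, ← Finset.mul_sum, hent, Finset.sum_const,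
          nsmul_eq_mul, Finset.card_univ]
        ring
      rw [Finset.sum_congr rfl h4, Finset.sum_add_distrib, Finset.sum_const,
        ← Finset.sum_mul, hrange, nsmul_eq_mul, Finset.card_range]
      ring
    rw [h3] at h1
    have h5 : K * (1 - K / N) * paidRounds lo hi (1 / 2) K M B - L / card
        = (card * (K * (1 - K / N)) * paidRounds lo hi (1 / 2) K M B - L) / card := by
      field_simp
    rw [h5, div_le_iff₀ hc]
    linarith
  have h6 := le_sqrt_of_forall_le (by positivity) (by positivity) hfinal
  have h7 : K * M / 2 * (K / 4 * (M * (M - 1) / 2 * ((K * K / N) * (bitsEntropy ε δ / 2))))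
      = (K ^ 2 / 4 : ℝ) ^ 2 * (bitsEntropy ε δ * (M ^ 2 * (M - 1)) / (2 * N)) := by
    field_simp
    ring
  rw [h7, Real.sqrt_mul (by positivity), Real.sqrt_sq (by positivity)] at h6
  rw [mul_comm, ← le_div_iff₀ hc]
  linarith

open MeasureTheory in
/-- The expected regret with respect to the good set, averaged over the good set. -/
theorem le_sum_integral_weakRegret (π : Policy N K) (hK : 1 ≤ K) (hKN : K ≤ N) (hlo : 0 ≤ lo)
    (hlh : lo ≤ hi) (hε0 : 0 ≤ ε) (hε1 : ε < 1 / 2) (hδ0 : 0 ≤ δ) (hδ1 : δ < 1 / 2) (c : ℝ)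
    {B : ℝ} (hB : 0 ≤ B) :
    ε * (K * (1 - K / N) * paidRounds lo hi (1 / 2) K (maxRounds K c B) B
        - K ^ 2 / 2 * √(bitsEntropy ε δ * ((maxRounds K c B : ℝ) ^ 2 * (maxRounds K c B - 1))
            / (2 * N)))
      ≤ (∑ s : Arms N K, ∫ ω, weakRegret π (twoCostEnvironment lo hi ω) c B
          ∂(twoBiasLaw ε δ s.1)) / (Fintype.card (Arms N K) : ℝ) := by
  have hc := card_arms_pos (N := N) hKN
  rw [le_div_iff₀ hc]
  have h1 := mul_le_mul_of_nonneg_left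
    (le_sum_plantedValue_missed π hK hKN hlo hlh hε0 hε1 hδ0 hδ1 hB (maxRounds K c B)) hε0
  rw [Finset.mul_sum] at h1
  refine le_trans (le_of_eq (by ring)) (h1.trans (Finset.sum_le_sum fun s _ => ?_))
  have h2 : ∫ ω, (gainWithin (fixedPolicy s) (twoCostEnvironment lo hi ω) (maxRounds K c B) [] B
        - gainWithin π (twoCostEnvironment lo hi ω) (maxRounds K c B) [] B) ∂(twoBiasLaw ε δ s.1)
      ≤ ∫ ω, weakRegret π (twoCostEnvironment lo hi ω) c B ∂(twoBiasLaw ε δ s.1) := by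
    refine integral_mono ?_ (integrable_weakRegret π lo hi c B _) fun ω => ?_
    · exact (integrable_gainWithin _ _ _ _ _ _ _).sub (integrable_gainWithin _ _ _ _ _ _ _)
    · exact sub_le_sub_right (le_ciSup (f := fun a : Arms N K =>
        expectedGain (fixedPolicy a) (twoCostEnvironment lo hi ω) c B)
        (Set.finite_range _).bddAbove s) _
  rw [integral_sub (integrable_gainWithin _ _ _ _ _ _ _) (integrable_gainWithin _ _ _ _ _ _ _)]
    at h2
  rw [integral_gainWithin _ _ _ hε0 hε1.le hδ0 hδ1.le, integral_gainWithin _ _ _ hε0 hε1.le hδ0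
    hδ1.le, plantedValue_fixedPolicy hlh hε0 hε1.le hδ0 hδ1.le] at h2
  have h3 := plantedValue_reward_le π hlh hε0 hε1.le hδ0 hδ1.le s.1 (maxRounds K c B) [] B
  linarith

end Regret

/-! ### Numerical estimates -/

theorem two_div_seven_le_log : (2 / 7 : ℝ) ≤ Real.log (4 / 3) := by
  have h : (2 : ℝ) ≤ Real.log ((4 / 3) ^ 7) := by
    rw [Real.le_log_iff_exp_le (by norm_num)]
    have h1 := Real.exp_one_lt_d9
    have h2 : Real.exp 2 = Real.exp 1 * Real.exp 1 := by
      rw [← Real.exp_add]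
      norm_num
    have h3 := Real.exp_pos 1
    rw [h2]
    nlinarith
  rw [Real.log_pow] at h
  push_cast at h
  linarith

theorem neg_log_one_sub_le {x : ℝ} (h0 : 0 ≤ x) (h1 : x ≤ 1 / 4) :
    -Real.log (1 - x) ≤ 4 * x * Real.log (4 / 3) := by
  have h := strictConcaveOn_log_Ioi.concaveOn.2
    (show (1 : ℝ) ∈ Set.Ioi 0 by simp) (show (3 / 4 : ℝ) ∈ Set.Ioi 0 by simp)
    (show 0 ≤ 1 - 4 * x by linarith) (show 0 ≤ 4 * x by linarith) (by ring)
  simp only [smul_eq_mul, Real.log_one, mul_zero, zero_add, mul_one] at h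
  have e1 : 1 - 4 * x + 4 * x * (3 / 4) = 1 - x := by ring
  have e2 : Real.log (3 / 4) = -Real.log (4 / 3) := by
    rw [← Real.log_inv]
    norm_num
  rw [e1, e2] at h
  linarith

theorem mul_sqrt_le_mul_sqrt {a b u v : ℝ} (ha : 0 ≤ a) (hb : 0 ≤ b)
    (h : a ^ 2 * u ≤ b ^ 2 * v) : a * √u ≤ b * √v := by
  have e : ∀ x y : ℝ, 0 ≤ x → x * √y = √(x ^ 2 * y) := fun x y hx => by
    rw [Real.sqrt_mul (sq_nonneg x), Real.sqrt_sq hx]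
  rw [e a u ha, e b v hb]
  exact Real.sqrt_le_sqrt h

theorem bitsEntropy_le {ε δ : ℝ} (hε0 : 0 ≤ ε) (hε1 : ε ≤ 1 / 4) (hδ0 : 0 ≤ δ) (hδ : δ ≤ ε) :
    bitsEntropy ε δ ≤ 32 * Real.log (4 / 3) * ε ^ 2 := by
  have h1 := neg_log_one_sub_le (x := 4 * ε ^ 2) (by positivity) (by nlinarith)
  have h2 := neg_log_one_sub_le (x := 4 * δ ^ 2) (by positivity) (by nlinarith)
  have h3 : δ ^ 2 ≤ ε ^ 2 := by nlinarith
  have h4 := mul_le_mul_of_nonneg_left h3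
    (by linarith [two_div_seven_le_log] : 0 ≤ 16 * Real.log (4 / 3))
  unfold bitsEntropy
  linarith

theorem rpow_neg_three_halves_sq {c : ℝ} (hc : 0 < c) :
    (c ^ (-(3 / 2) : ℝ)) ^ 2 = (c ^ 3)⁻¹ := by
  rw [← Real.rpow_natCast, ← Real.rpow_mul hc.le]
  rw [show (-(3 / 2) : ℝ) * (2 : ℕ) = -((3 : ℕ) : ℝ) by norm_num, Real.rpow_neg hc.le,
    Real.rpow_natCast]

/-- The lower bound on the regret as a function of the bias `ε`. -/
def regretBound (N K : ℕ) (c B ε : ℝ) : ℝ :=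
  ε * (B - B * K / N - 2 * B * c ^ (-(3 / 2) : ℝ) * ε * √(B * K * Real.log (4 / 3) / N))

/-- The bias that optimizes the lower bound. -/
def optimalBias (N K : ℕ) (c B : ℝ) : ℝ :=
  min (1 / 4) ((1 - K / N) * c ^ (3 / 2 : ℝ) / (4 * √(Real.log (4 / 3))) * √(N / (B * K)))

section Bounds

variable {N K : ℕ} {c B : ℝ}

theorem one_sub_div_nonneg (hK : 1 ≤ K) (hKN : K ≤ N) : (0 : ℝ) ≤ 1 - K / N := by
  have hN : (0 : ℝ) < N := by exact_mod_cast (by omega : 0 < N)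
  rw [sub_nonneg, div_le_one hN]
  exact_mod_cast hKN

theorem optimalBias_mem (hK : 1 ≤ K) (hKN : K ≤ N) (hc : 0 < c) :
    optimalBias N K c B ∈ Set.Icc (0 : ℝ) (1 / 4) := by
  have := one_sub_div_nonneg hK hKN
  exact ⟨le_min (by norm_num) (by positivity), min_le_left _ _⟩

theorem le_regretBound_optimalBias (hK : 1 ≤ K) (hKN : K ≤ N) (hc : 0 < c) (hB : 0 < B) :
    min (c ^ (3 / 2 : ℝ) * (1 - K / N) ^ 2 / (8 * √(Real.log (4 / 3))) * √(N * B / K))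
        (B * (1 - K / N) / 8) ≤ regretBound N K c B (optimalBias N K c B) := by
  have hN : (0 : ℝ) < N := by exact_mod_cast (by omega : 0 < N)
  have hK' : (0 : ℝ) < K := by exact_mod_cast hK
  have hA := one_sub_div_nonneg hK hKN
  have hℓ : 0 < Real.log (4 / 3) := by linarith [two_div_seven_le_log]
  have hv : 0 < c ^ (3 / 2 : ℝ) := by positivity
  have hR : 0 < √(Real.log (4 / 3)) := Real.sqrt_pos.2 hℓ
  unfold regretBound optimalBias
  rw [Real.rpow_neg hc.le]
  have hBA : B - B * K / N = B * (1 - K / N) := by ring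
  rw [hBA]
  generalize (1 - K / N : ℝ) = A at hA ⊢
  generalize c ^ (3 / 2 : ℝ) = v at hv ⊢
  have hS : √(N / (B * K)) * √(B * K * Real.log (4 / 3) / N) = √(Real.log (4 / 3)) := by
    rw [← Real.sqrt_mul (by positivity)]
    congr 1
    field_simp
  have hT : √(N * B / K) = B * √(N / (B * K)) := by
    rw [← Real.sqrt_sq hB.le, ← Real.sqrt_mul (by positivity), Real.sqrt_sq hB.le]
    congr 1
    field_simp
  rw [hT]
  generalize √(N / (B * K)) = T at hS ⊢
  have hS0 : 0 ≤ √(B * K * Real.log (4 / 3) / N) := Real.sqrt_nonneg _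
  generalize √(B * K * Real.log (4 / 3) / N) = S at hS hS0 ⊢
  generalize √(Real.log (4 / 3)) = R at hS hR ⊢
  have hopt : 2 * B * v⁻¹ * (A * v / (4 * R) * T) * S = B * A / 2 := by
    rw [← hS] at hR ⊢
    have : T ≠ 0 := fun h => by simp [h] at hR
    have : S ≠ 0 := fun h => by simp [h] at hR
    field_simp
    ring
  rcases le_total (1 / 4) (A * v / (4 * R) * T) with h | h
  · rw [min_eq_left h]
    refine (min_le_right _ _).trans ?_
    have h1 : 2 * B * v⁻¹ * (1 / 4) * S ≤ 2 * B * v⁻¹ * (A * v / (4 * R) * T) * S := by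
      gcongr
    linarith
  · rw [min_eq_right h, hopt]
    refine (min_le_left _ _).trans (le_of_eq ?_)
    field_simp
    ring

theorem penalty_le (hc : 0 < c) (hB : 0 ≤ B) {ε κ M : ℝ} (hε0 : 0 ≤ ε)
    (hκ0 : 0 ≤ κ) (hκ : κ ≤ 32 * Real.log (4 / 3) * ε ^ 2) (hM0 : 0 ≤ M)
    (hM : K * M * c ≤ B) :
    (K : ℝ) ^ 2 / 2 * √(κ * (M ^ 2 * (M - 1)) / (2 * N))
      ≤ 2 * B * c ^ (-(3 / 2) : ℝ) * ε * √(B * K * Real.log (4 / 3) / N) := by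
  have hℓ : 0 < Real.log (4 / 3) := by linarith [two_div_seven_le_log]
  refine mul_sqrt_le_mul_sqrt (by positivity) (by positivity) ?_
  have e : (2 * B * c ^ (-(3 / 2) : ℝ) * ε) ^ 2 = 4 * B ^ 2 * ε ^ 2 * (c ^ 3)⁻¹ := by
    rw [← rpow_neg_three_halves_sq hc]
    ring
  rw [e]
  have h1 : (K * M) ^ 3 ≤ B ^ 3 * (c ^ 3)⁻¹ := by
    rw [← div_eq_mul_inv, le_div_iff₀ (by positivity), ← mul_pow]
    gcongr
  calc ((K : ℝ) ^ 2 / 2) ^ 2 * (κ * (M ^ 2 * (M - 1)) / (2 * N))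
      ≤ ((K : ℝ) ^ 2 / 2) ^ 2 * (κ * M ^ 3 / (2 * N)) := by
        gcongr
        nlinarith [sq_nonneg M]
    _ ≤ ((K : ℝ) ^ 2 / 2) ^ 2 * (32 * Real.log (4 / 3) * ε ^ 2 * M ^ 3 / (2 * N)) := by
        gcongr
    _ = (4 * ε ^ 2 * K * Real.log (4 / 3) / N) * (K * M) ^ 3 := by
        rcases eq_or_ne (N : ℝ) 0 with h | h
        · simp [h]
        · field_simp
          ring
    _ ≤ (4 * ε ^ 2 * K * Real.log (4 / 3) / N) * (B ^ 3 * (c ^ 3)⁻¹) := by gcongr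
    _ = _ := by ring

theorem cast_maxRounds_mul_le (hK : 1 ≤ K) (hc : 0 < c) (hB : 0 ≤ B) :
    K * (maxRounds K c B : ℝ) * c ≤ B := by
  have hpos : (0 : ℝ) < K * c := mul_pos (by exact_mod_cast hK) hc
  have := Nat.floor_le (div_nonneg hB hpos.le)
  rw [le_div_iff₀ hpos] at this
  unfold maxRounds
  linarith

theorem lt_cast_maxRounds_add_one_mul (hK : 1 ≤ K) (hc : 0 < c) :
    B < ((maxRounds K c B : ℝ) + 1) * (K * c) := by
  have hpos : (0 : ℝ) < K * c := mul_pos (by exact_mod_cast hK) hc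
  rw [← div_lt_iff₀ hpos]
  exact Nat.lt_floor_add_one _

theorem one_le_maxRounds (hK : 1 ≤ K) (hc : 0 < c) (hB : K * c ≤ B) : 1 ≤ maxRounds K c B := by
  have hpos : (0 : ℝ) < K * c := mul_pos (by exact_mod_cast hK) hc
  refine Nat.le_floor ?_
  rw [le_div_iff₀ hpos]
  simpa using hB

/-- The random environment with two cost values attains the bound as soon as fair arms can be
played for `B / K` rounds in expectation. -/
theorem regretBound_le_average (π : Policy N K) (hK : 1 ≤ K) (hKN : K ≤ N) (hc : 0 < c)
    (hB : 0 ≤ B) {lo hi : ℝ} (hlo : 0 ≤ lo) (hlh : lo ≤ hi) {ε δ : ℝ} (hε0 : 0 ≤ ε)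
    (hε1 : ε ≤ 1 / 4) (hδ0 : 0 ≤ δ) (hδ : δ ≤ ε)
    (hτ : B ≤ K * paidRounds lo hi (1 / 2) K (maxRounds K c B) B) :
    regretBound N K c B ε
      ≤ (∑ s : Arms N K, ∫ ω, weakRegret π (twoCostEnvironment lo hi ω) c B
          ∂(twoBiasLaw ε δ s.1)) / (Fintype.card (Arms N K) : ℝ) := by
  refine le_trans ?_ (le_sum_integral_weakRegret π hK hKN hlo hlh hε0 (by linarith) hδ0
    (by linarith) c hB)
  refine mul_le_mul_of_nonneg_left ?_ hε0
  have h1 := mul_le_mul_of_nonneg_right hτ (one_sub_div_nonneg hK hKN)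
  have h2 := penalty_le (N := N) hc hB hε0
    (bitsEntropy_nonneg hε0 (by linarith) hδ0 (by linarith))
    (bitsEntropy_le hε0 hε1 hδ0 hδ) (Nat.cast_nonneg _) (cast_maxRounds_mul_le hK hc hB)
  have e : B - B * K / N = B * (1 - K / N) := by ring
  rw [e]
  linarith

theorem regretBound_le_plantedRegret (π : Policy N K) (hK : 1 ≤ K) (hKN : K ≤ N) (hc : 0 < c)
    (hc1 : c ≤ 1) (hB : K * c ≤ B)
    (hcond : (∃ m : ℕ, 1 ≤ m ∧ B = m * K) ∨ K * (1 + c) ≤ B * (1 - c)) {ε : ℝ} (hε0 : 0 ≤ ε)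
    (hε1 : ε ≤ 1 / 4) : regretBound N K c B ε ≤ plantedRegret π ε c B := by
  have hB0 : 0 ≤ B := le_trans (by positivity) hB
  have hK' : (0 : ℝ) < K := by exact_mod_cast hK
  refine regretBound_le_average (lo := c) (hi := 1) (δ := ε) π hK hKN hc hB0 hc.le hc1 hε0 hε1
    hε0 le_rfl ?_
  rcases hcond with ⟨m, -, hm⟩ | hcond
  · have hmM : m ≤ maxRounds K c B := by
      refine Nat.le_floor ?_
      rw [le_div_iff₀ (by positivity), hm]
      have : (K : ℝ) * c ≤ K * 1 := by gcongr
      have hm0 : (0 : ℝ) ≤ m := Nat.cast_nonneg m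
      nlinarith
    have := le_paidRounds (lo := c) (hi := 1) (q := 1 / 2) (K := K) (by norm_num) (by norm_num)
      hc1 zero_le_one hmM (b := B) (by rw [hm, mul_one])
    calc B = K * m := by rw [hm, mul_comm]
      _ ≤ _ := by gcongr
  · have h := le_meanCost_mul_paidRounds (K := K) (q := 1 / 2) (by norm_num) (by norm_num) hc.le
      hc1 (maxRounds K c B) (lt_cast_maxRounds_add_one_mul hK hc)
    have h1 : 0 < 1 + c := by linarith
    refine le_of_mul_le_mul_left ?_ h1
    linarith

open MeasureTheory in
theorem exists_weakRegret_ge (π : Policy N K) (hKN : K ≤ N) {lo hi : ℝ} (hlo : c ≤ lo)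
    (hlh : lo ≤ hi) (hhi : hi ≤ 1) {ε δ r : ℝ}
    (hr : r ≤ (∑ s : Arms N K, ∫ ω, weakRegret π (twoCostEnvironment lo hi ω) c B
          ∂(twoBiasLaw ε δ s.1)) / (Fintype.card (Arms N K) : ℝ)) :
    ∃ x : Environment N, x.IsAdmissible c ∧ weakRegret π x c B ≥ r := by
  have hcard := card_arms_pos (N := N) hKN
  rw [le_div_iff₀ hcard] at hr
  have : Nonempty (Arms N K) := Fintype.card_pos_iff.1 (by exact_mod_cast hcard)
  obtain ⟨s, -, hs⟩ := Finset.exists_le_of_sum_le (s := (Finset.univ : Finset (Arms N K)))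
    (f := fun _ => r)
    (g := fun s => ∫ ω, weakRegret π (twoCostEnvironment lo hi ω) c B ∂(twoBiasLaw ε δ s.1)) Finset.univ_nonempty (by
      rw [Finset.sum_const, nsmul_eq_mul, Finset.card_univ, mul_comm]
      exact hr)
  obtain ⟨ω, hω⟩ := exists_integral_le (integrable_weakRegret π lo hi c B (twoBiasLaw ε δ s.1))
  exact ⟨_, twoCostEnvironment_isAdmissible hlo hlh hhi ω, hs.trans hω⟩

/-- When all costs are `1` and the budget pays for fewer than `B / K` rounds, a larger bias makes
up for the missing rounds. -/
theorem regretBound_le_average_of_lt (π : Policy N K) (hK : 1 ≤ K) (hKN : K ≤ N) (hc : 0 < c)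
    (hc1 : c ≤ 1) (hB : K * c ≤ B) (hMB : K * (maxRounds K c B : ℝ) < B) {ε : ℝ}
    (hε0 : 0 ≤ ε) (hε1 : ε ≤ 1 / 4) :
    regretBound N K c B ε
      ≤ (∑ s : Arms N K, ∫ ω, weakRegret π (twoCostEnvironment 1 1 ω) c B
          ∂(twoBiasLaw (ε * (B / (K * maxRounds K c B))) 0 s.1))
        / (Fintype.card (Arms N K) : ℝ) := by
  have hK' : (0 : ℝ) < K := by exact_mod_cast hK
  have hN : (0 : ℝ) < N := by exact_mod_cast (by omega : 0 < N)
  have hB0 : 0 ≤ B := le_trans (by positivity) hB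
  have hℓ := two_div_seven_le_log
  have hA := one_sub_div_nonneg hK hKN
  have hM1 : 1 ≤ maxRounds K c B := one_le_maxRounds hK hc hB
  have hτ := le_paidRounds (lo := 1) (hi := 1) (q := 1 / 2) (K := K) (by norm_num) (by norm_num)
      le_rfl zero_le_one (le_refl (maxRounds K c B)) (b := B) (by linarith)
  have hlt : B < ((maxRounds K c B : ℝ) + 1) * K := by
    refine (lt_cast_maxRounds_add_one_mul hK hc).trans_le ?_
    have : (K : ℝ) * c ≤ K * 1 := by gcongr
    nlinarith [Nat.cast_nonneg (α := ℝ) (maxRounds K c B)]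
  have hmain := fun h => le_sum_integral_weakRegret (lo := 1) (hi := 1) (δ := 0)
    (ε := ε * (B / (K * maxRounds K c B))) π hK hKN zero_le_one le_rfl (by positivity) h le_rfl
    (by norm_num) c hB0
  have hM1' : (1 : ℝ) ≤ maxRounds K c B := by exact_mod_cast hM1
  have hM2 : (maxRounds K c B : ℝ) = 1 ∨ (2 : ℝ) ≤ maxRounds K c B :=
    hM1.eq_or_lt.imp (fun h => by rw [← h, Nat.cast_one]) fun h => by exact_mod_cast h
  set ρ := B / (K * maxRounds K c B) with hρ
  have hBρ : B = ρ * (K * maxRounds K c B) := by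
    rw [hρ]
    field_simp
  generalize hMdef : (maxRounds K c B : ℝ) = M at *
  have hρ1 : 1 < ρ := by
    rw [hρ, one_lt_div (by positivity)]
    exact hMB
  have hρM : ρ * M < M + 1 := by
    rw [hBρ] at hlt
    have : ρ * M * K < (M + 1) * K := by linarith
    exact lt_of_mul_lt_mul_right this hK'.le
  have hε' : ε * ρ < 1 / 2 := by nlinarith
  refine le_trans ?_ (hmain hε')
  have hw : 1 ≤ c ^ (-(3 / 2) : ℝ) :=
    Real.one_le_rpow_of_pos_of_le_one_of_nonpos hc hc1 (by norm_num)
  have hpen : ρ * (K ^ 2 / 2) * √(bitsEntropy (ε * ρ) 0 * (M ^ 2 * (M - 1)) / (2 * N))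
      ≤ 2 * B * c ^ (-(3 / 2) : ℝ) * ε * √(B * K * Real.log (4 / 3) / N) := by
    have h1 : ρ * (K ^ 2 / 2) * √(bitsEntropy (ε * ρ) 0 * (M ^ 2 * (M - 1)) / (2 * N))
        ≤ 2 * B * ε * √(B * K * Real.log (4 / 3) / N) := by
      refine mul_sqrt_le_mul_sqrt (by positivity) (by positivity) ?_
      have hκ : bitsEntropy (ε * ρ) 0 * (M - 1)
          ≤ 32 * ρ * M * ε ^ 2 * Real.log (4 / 3) := by
        rcases hM2 with h | h
        · rw [h, sub_self, mul_zero]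
          have : 0 ≤ Real.log (4 / 3) := by linarith
          positivity
        · have hρ2 : ρ ≤ 3 / 2 := by nlinarith
          have h38 : ε * ρ ≤ 3 / 8 := by nlinarith
          have hy : 7 / 16 ≤ 1 - 4 * (ε * ρ) ^ 2 := by
            have : 0 ≤ ε * ρ := by positivity
            nlinarith
          have hlog := Real.one_sub_inv_le_log_of_pos (x := 1 - 4 * (ε * ρ) ^ 2) (by linarith)
          have hκ' : bitsEntropy (ε * ρ) 0 ≤ 64 / 7 * (ε * ρ) ^ 2 := by
            have hinv : (1 - 4 * (ε * ρ) ^ 2)⁻¹ - 1 ≤ 64 / 7 * (ε * ρ) ^ 2 := by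
              rw [sub_le_iff_le_add, inv_le_iff_one_le_mul₀ (by linarith)]
              nlinarith [sq_nonneg (ε * ρ)]
            simp only [bitsEntropy, ne_eq, OfNat.ofNat_ne_zero, not_false_eq_true, zero_pow,
              mul_zero, sub_zero, Real.log_one]
            linarith
          calc bitsEntropy (ε * ρ) 0 * (M - 1) ≤ 64 / 7 * (ε * ρ) ^ 2 * (M - 1) := by
                refine mul_le_mul_of_nonneg_right hκ' (by linarith)
            _ = 64 / 7 * ρ * ε ^ 2 * (ρ * (M - 1)) := by ring
            _ ≤ 64 / 7 * ρ * ε ^ 2 * M := by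
                refine mul_le_mul_of_nonneg_left (by linarith) (by positivity)
            _ = 32 * ρ * M * ε ^ 2 * (2 / 7) := by ring
            _ ≤ _ := mul_le_mul_of_nonneg_left hℓ (by positivity)
      calc (ρ * (K ^ 2 / 2)) ^ 2 * (bitsEntropy (ε * ρ) 0 * (M ^ 2 * (M - 1)) / (2 * N))
          = ρ ^ 2 * K ^ 4 * M ^ 2 / (8 * N) * (bitsEntropy (ε * ρ) 0 * (M - 1)) := by
            field_simp
            ring
        _ ≤ ρ ^ 2 * K ^ 4 * M ^ 2 / (8 * N) * (32 * ρ * M * ε ^ 2 * Real.log (4 / 3)) := by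
            gcongr
        _ = (2 * (ρ * (K * M)) * ε) ^ 2 * (ρ * (K * M) * K * Real.log (4 / 3) / N) := by
            field_simp
            ring
        _ = _ := by rw [← hBρ]
    refine h1.trans ?_
    have h2 : 0 ≤ 2 * B * ε * √(B * K * Real.log (4 / 3) / N) := by positivity
    nlinarith [mul_le_mul_of_nonneg_right hw h2]
  have h5 := mul_le_mul_of_nonneg_left hτ (by positivity : 0 ≤ ε * ρ * (K * (1 - K / N)))
  have h6 : ε * ρ * (K * (1 - K / N)) * M = ε * (B - B * K / N) := by
    have : B - B * K / N = ρ * (K * M) * (1 - K / N) := by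
      rw [← hBρ]
      ring
    rw [this]
    ring
  have h7 := mul_le_mul_of_nonneg_left hpen hε0
  unfold regretBound
  linarith

theorem exists_weakRegret_ge_regretBound (π : Policy N K) (hK : 1 ≤ K) (hKN : K ≤ N) (hc : 0 < c)
    (hc1 : c ≤ 1) (hB : K * c ≤ B) {ε : ℝ} (hε0 : 0 ≤ ε) (hε1 : ε ≤ 1 / 4) :
    ∃ x : Environment N, x.IsAdmissible c ∧ weakRegret π x c B ≥ regretBound N K c B ε := by
  have hK' : (0 : ℝ) < K := by exact_mod_cast hK
  have hB0 : 0 < B := lt_of_lt_of_le (by positivity) hB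
  rcases lt_or_ge (K * (maxRounds K c B : ℝ)) B with h | h
  · exact exists_weakRegret_ge π hKN hc1 le_rfl le_rfl
      (regretBound_le_average_of_lt π hK hKN hc hc1 hB h hε0 hε1)
  · have hM : (0 : ℝ) < maxRounds K c B := by
      exact_mod_cast one_le_maxRounds hK hc hB
    have hKM : 0 < K * (maxRounds K c B : ℝ) := by positivity
    set u := B / (K * maxRounds K c B) with hu
    have hu0 : 0 ≤ u := by positivity
    have hcu : c ≤ u := by
      rw [hu, le_div_iff₀ hKM]
      linarith [cast_maxRounds_mul_le hK hc hB0.le]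
    have hu1 : u ≤ 1 := (div_le_one hKM).2 h
    refine exists_weakRegret_ge π hKN hcu le_rfl hu1
      (regretBound_le_average (δ := 0) π hK hKN hc hB0.le hu0 le_rfl hε0 hε1 le_rfl hε0 ?_)
    have hτ := le_paidRounds (lo := u) (hi := u) (q := 1 / 2) (K := K) (by norm_num)
      (by norm_num) le_rfl hu0 (le_refl (maxRounds K c B)) (b := B) (le_of_eq (by
        rw [hu]
        field_simp))
    exact h.trans (mul_le_mul_of_nonneg_left hτ hK'.le)

end Bounds

end BudgetedBandit

end

theorem theorem3 (N K : ℕ) (hK : 1 ≤ K) (hKN : K ≤ N)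
    (c : ℝ) (hc0 : 0 < c) (hc1 : c ≤ 1) (B : ℝ) (hB : K * c ≤ B) :
    let claim : BudgetedBandit.Policy N K → Prop := fun π =>
      -- the worst-case weak regret, for every ε and for the best choice of ε
      (∀ ε ∈ Set.Ioc (0 : ℝ) (1 / 4), ∃ x : BudgetedBandit.Environment N, x.IsAdmissible c ∧
        BudgetedBandit.weakRegret π x c B ≥
          ε * (B - B * K / N -
            2 * B * c ^ (-(3 / 2) : ℝ) * ε * √(B * K * Real.log (4 / 3) / N))) ∧
      (∃ x : BudgetedBandit.Environment N, x.IsAdmissible c ∧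
        BudgetedBandit.weakRegret π x c B ≥
          min (c ^ (3 / 2 : ℝ) * (1 - K / N) ^ 2 / (8 * √(Real.log (4 / 3))) * √(N * B / K))
            (B * (1 - K / N) / 8)) ∧
      -- the random environment with K good arms attains these bounds
      ((∃ m : ℕ, 1 ≤ m ∧ B = m * K) ∨ K * (1 + c) ≤ B * (1 - c) →
        (∀ ε ∈ Set.Ioc (0 : ℝ) (1 / 4),
          (∀ s : BudgetedBandit.Arms N K, MeasureTheory.Integrable
            (fun ω => BudgetedBandit.weakRegret π (BudgetedBandit.bitEnvironment c ω) c B)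
            (BudgetedBandit.plantedLaw ε s.1)) ∧
          BudgetedBandit.plantedRegret π ε c B ≥
            ε * (B - B * K / N -
              2 * B * c ^ (-(3 / 2) : ℝ) * ε * √(B * K * Real.log (4 / 3) / N))) ∧
        BudgetedBandit.plantedRegret π
            (min (1 / 4) ((1 - K / N) * c ^ (3 / 2 : ℝ) / (4 * √(Real.log (4 / 3))) *
              √(N / (B * K)))) c B ≥
          min (c ^ (3 / 2 : ℝ) * (1 - K / N) ^ 2 / (8 * √(Real.log (4 / 3))) * √(N * B / K))
            (B * (1 - K / N) / 8))
    (∀ π : BudgetedBandit.Policy N K, claim π) ∧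
      ∀ γ ∈ Set.Ioc (0 : ℝ) 1, ∀ D : BudgetedBandit.Rounding N K,
        claim (BudgetedBandit.exp3MB γ D) := by
  intro claim
  have hB0 : 0 < B := lt_of_lt_of_le (mul_pos (by exact_mod_cast hK) hc0) hB
  have hopt := BudgetedBandit.optimalBias_mem (B := B) hK hKN hc0
  have hle := BudgetedBandit.le_regretBound_optimalBias hK hKN hc0 hB0
  have main : ∀ π, claim π := by
    refine fun π => ⟨fun ε hε => ?_, ?_, fun hcond => ⟨fun ε hε => ⟨fun s => ?_, ?_⟩, ?_⟩⟩
    · exact BudgetedBandit.exists_weakRegret_ge_regretBound π hK hKN hc0 hc1 hB hε.1.le hε.2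
    · obtain ⟨x, hx, hr⟩ := BudgetedBandit.exists_weakRegret_ge_regretBound π hK hKN hc0 hc1 hB
        hopt.1 hopt.2
      exact ⟨x, hx, hle.trans hr⟩
    · exact BudgetedBandit.integrable_weakRegret π c 1 c B (BudgetedBandit.twoBiasLaw ε ε s.1)
    · exact BudgetedBandit.regretBound_le_plantedRegret π hK hKN hc0 hc1 hB hcond hε.1.le hε.2
    · exact hle.trans (BudgetedBandit.regretBound_le_plantedRegret π hK hKN hc0 hc1 hB hcond
        hopt.1 hopt.2)
  exact ⟨main, fun γ _ D => main _⟩
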